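/- Let $N\ge 2$. Consider a game with players $i=1,\dots,N$, actions $x_i\in\mathbb R$, $\mathbf x=(x_1,\dots,x_N)^T$, and costs $f_i:\mathbb R^N\to\mathbb R$, player $i$ minimizing $f_i$ over its own action $x_i$. A profile $\mathbf x^*$ is a Nash equilibrium if $f_i(x_i^*,\mathbf x_{-i}^*)\le f_i(x_i,\mathbf x_{-i}^*)$ for all $i$ and all $x_i\in\mathbb R$. The norm $\|\cdot\|$ is the Euclidean norm. Assume: 1. each $f_i$ is twice continuously differentiable; 2. there is $m>0$ such that $(\mathbf x-\mathbf z)^T(\Upsilon(\mathbf x)-\Upsilon(\mathbf z))\ge m\|\mathbf x-\mathbf z\|^2$ for all $\mathbf x,\mathbf z\in\mathbb R^N$, where $\Upsilon(\mathbf x)=\big(\tfrac{\partial f_i}{\partial x_i}(\mathbf x)\big)_{i=1}^N$; 3. $(a_{ij})$ is the weighted adjacency matrix of an undirected connected graph on $\{1,\dots,N\}$: $a_{ij}=a_{ji}\ge 0$, $a_{ii}=0$, and the graph whose edges are the pairs with $a_{ij}>0$ is connected; 4. each disturbance $d_i:[t_0,\infty)\to\mathbb R$ is continuously differentiable with bounded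 derivative. Let $\bar\theta_{ij},k_{i1},k_{i2}$ be fixed positive constants. For $\theta,\sigma>0$ consider, on $[t_0,\infty)$, the dynamics $\dot x_i=u_i+d_i(t)$ with the strategy $$u_i=-\frac{\partial f_i}{\partial x_i}(\mathbf y_i)-\hat z_i,\qquad \mathbf y_i=(y_{i1},\dots,y_{iN})^T,$$ $$\dot y_{ij}=-\theta\bar\theta_{ij}\Big(\sum_{k=1}^N a_{ik}(y_{ij}-y_{kj})+a_{ij}(y_{ij}-x_j)\Big),$$ $$\dot{\hat x}_i=u_i+\hat z_i+\sigma k_{i1}(x_i-\hat x_i),\qquad \dot{\hat z}_i=\sigma^2k_{i2}(x_i-\hat x_i).$$ Then the game has exactly one Nash equilibrium $\mathbf x^*$. Let $\mathcal E(t)$ be the vector that stacks all the errors $x_i-\hat x_i$, $d_i(t)-\hat z_i$, $y_{ij}-x_j$ and $x_i-x_i^*$ ($1\le i,j\le N$) at time $t$. For any $v_1,v_2>0$ there are $\theta^*>0$ and $\sigma^*>0$ such that for all $\theta>\theta^*$ and all $\sigma>\sigma^*$: from every initial state with $\|\mathcal E(t_0)\|\le v_1$ the closed-loop system has a solution on $[t_0,\infty)$,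 and there is $\bar T\ge t_0$ such that every solution on $[t_0,\infty)$ with $\|\mathcal E(t_0)\|\le v_1$ satisfies $\|\mathcal E(t)\|\le v_2$ for all $t\ge\bar T$. -/

import Mathlib

open Set

noncomputable section

namespace NashPI

/-- The partial derivative `∂f_i/∂x_i` of player `i`'s cost with respect to its own action,
evaluated at the action profile `x`. -/
def ownPartial {N : ℕ} (f : Fin N → (Fin N → ℝ) → ℝ) (i : Fin N) (x : Fin N → ℝ) : ℝ :=
  fderiv ℝ (f i) x (Pi.single i 1)

/-- The pseudo-gradient `Υ(x) = [∂f_i/∂x_i (x)]_vec`. -/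
def pseudoGradient {N : ℕ} (f : Fin N → (Fin N → ℝ) → ℝ) (x : Fin N → ℝ) : Fin N → ℝ :=
  fun i => ownPartial f i x

/-- Strong monotonicity of the pseudo-gradient with constant `m`
(the norm is the Euclidean one). -/
def StronglyMonotone {N : ℕ} (f : Fin N → (Fin N → ℝ) → ℝ) (m : ℝ) : Prop :=
  ∀ x z : Fin N → ℝ,
    m * ‖WithLp.toLp 2 (x - z)‖ ^ 2 ≤ (x - z) ⬝ᵥ (pseudoGradient f x - pseudoGradient f z)

/-- Nash equilibrium: no player can decrease its cost by a unilateral deviation. -/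
def IsNash {N : ℕ} (f : Fin N → (Fin N → ℝ) → ℝ) (xs : Fin N → ℝ) : Prop :=
  ∀ (i : Fin N) (r : ℝ), f i xs ≤ f i (Function.update xs i r)

/-- `a` is the weighted adjacency matrix of an undirected connected graph without self-loops,
whose edges are the pairs of nodes with positive weight. -/
structure IsUndirectedConnected {N : ℕ} (a : Matrix (Fin N) (Fin N) ℝ) : Prop where
  nonneg : ∀ i j, 0 ≤ a i j
  diag : ∀ i, a i i = 0
  symm : ∀ i j, a i j = a j i
  connected : (SimpleGraph.fromRel fun i j => 0 < a i j).Connected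

/-- `w` is continuously differentiable with bounded derivative on `[t₀, ∞)`. -/
def IsAdmissibleDisturbance (t₀ : ℝ) (w : ℝ → ℝ) : Prop :=
  ContDiffOn ℝ 1 w (Ici t₀) ∧ ∃ B : ℝ, ∀ t ∈ Ici t₀, |derivWithin w (Ici t₀) t| ≤ B

/-- State of the closed loop: the actions `x i`, player `i`'s estimate `y i j` of player `j`'s
action, and the observer states `xhat i`, `zhat i`. -/
structure State (N : ℕ) where
  x : Fin N → ℝ
  y : Fin N → Fin N → ℝ
  xhat : Fin N → ℝ
  zhat : Fin N → ℝ

/-- The control law `u_i = -∂f_i/∂x_i (y_i) - ẑ_i`. -/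
def control {N : ℕ} (f : Fin N → (Fin N → ℝ) → ℝ) (s : State N) (i : Fin N) : ℝ :=
  -ownPartial f i (s.y i) - s.zhat i

/-- `s` solves the closed-loop system on `[t₀, ∞)` (with a one-sided derivative at `t₀`). -/
structure IsSolution {N : ℕ} (f : Fin N → (Fin N → ℝ) → ℝ) (a : Matrix (Fin N) (Fin N) ℝ)
    (t₀ : ℝ) (d : Fin N → ℝ → ℝ) (k₁ k₂ : Fin N → ℝ) (θbar : Fin N → Fin N → ℝ)
    (θ σ : ℝ) (s : ℝ → State N) : Prop where
  ode_x : ∀ i, ∀ t ∈ Ici t₀,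
    HasDerivWithinAt (fun τ => (s τ).x i) (control f (s t) i + d i t) (Ici t₀) t
  ode_y : ∀ i j, ∀ t ∈ Ici t₀,
    HasDerivWithinAt (fun τ => (s τ).y i j)
      (-(θ * θbar i j) * ((∑ k, a i k * ((s t).y i j - (s t).y k j))
        + a i j * ((s t).y i j - (s t).x j))) (Ici t₀) t
  ode_xhat : ∀ i, ∀ t ∈ Ici t₀,
    HasDerivWithinAt (fun τ => (s τ).xhat i)
      (control f (s t) i + (s t).zhat i + (σ * k₁ i) * ((s t).x i - (s t).xhat i)) (Ici t₀) t
  ode_zhat : ∀ i, ∀ t ∈ Ici t₀,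
    HasDerivWithinAt (fun τ => (s τ).zhat i)
      ((σ ^ 2 * k₂ i) * ((s t).x i - (s t).xhat i)) (Ici t₀) t

/-- The stacked error `(ζ₁, ζ₂, η, ξ)` relative to the action profile `xs`, when the current value
of the disturbance is `w`: `ζ₁ = x - x̂`, `ζ₂ = w - ẑ`, `η i j = y i j - x j`, `ξ = x - xs`. -/
def errorVec {N : ℕ} (xs w : Fin N → ℝ) (s : State N) :
    EuclideanSpace ℝ ((Fin N ⊕ Fin N) ⊕ ((Fin N × Fin N) ⊕ Fin N)) :=
  WithLp.toLp 2 (Sum.elim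
    (Sum.elim (fun i => s.x i - s.xhat i) (fun i => w i - s.zhat i))
    (Sum.elim (fun p => s.y p.1 p.2 - s.x p.2) (fun i => s.x i - xs i)))

end NashPI

end

/-!
Monotonicity identifies Nash equilibria with zeros of the pseudo-gradient, so there is exactly one.
Relative to it, use the errors `e = (x - x̂, (d - ẑ) / σ)` of the observer, `p = x - x* - ℓ(e)`, and
`q i j = y i j - x* j - p j`, where `ℓ(e) j = e₁ j - (k₁ j / k₂ j) e₂ j` is chosen so that `e` drops
out of the dynamics of `p`. Then `e` decays at rate `σ` up to a remainder of order `1 / σ`, `q` at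
rate `θ` up to multiples of `e` and remainders of order `1 / θ`, because the pinned Laplacians are
coercive, and `p` follows gradient play perturbed by `q` and by terms of order `1 / σ`.

Three Lyapunov functions, for `e`, `q` and `p`, satisfy the corresponding cascade of differential
inequalities as long as they stay below a level `R`, beyond which nothing is assumed of the costs.
For large gains `e` and then `q` become small before `p` can leave its level set, so the bounds
persist and all three functions eventually become small. Existence follows by solving the equation
with a globally Lipschitz field which agrees with the true one below level `R`.
-/

noncomputable section

namespace NashPI

open Filter Topology

theorem two_mul_le_mul_sq_add_sq_div {r : ℝ} (hr : 0 < r) (a b : ℝ) :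
    2 * a * b ≤ r * a ^ 2 + b ^ 2 / r := by
  have h : r * a ^ 2 + b ^ 2 / r - 2 * a * b = (r * a - b) ^ 2 / r := by field_simp; ring
  linarith [div_nonneg (sq_nonneg (r * a - b)) hr.le]

theorem eventually_nhdsGT_le_of_hasDerivWithinAt_neg {V : ℝ → ℝ} {v t : ℝ}
    (hV : HasDerivWithinAt V v (Ici t) t) (hv : v < 0) : ∀ᶠ s in 𝓝[>] t, V s ≤ V t := by
  filter_upwards [(hV.mono Ioi_subset_Ici_self).limsup_slope_le' self_notMem_Ioi hv,
    self_mem_nhdsWithin] with s hs hts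
  rw [slope_def_field, div_lt_iff₀ (sub_pos.2 hts), zero_mul, sub_neg] at hs
  exact hs.le

/-- Nagumo's condition for the region `{V i ≤ c i}`. -/
theorem forall_le_of_hasDerivWithinAt_neg {ι : Type*} [Finite ι] {V : ι → ℝ → ℝ} {c : ι → ℝ}
    {t₀ : ℝ} (hcont : ∀ i, ContinuousOn (V i) (Ici t₀)) (h0 : ∀ i, V i t₀ ≤ c i)
    (hder : ∀ t, t₀ ≤ t → (∀ i, V i t ≤ c i) → ∀ i, V i t = c i →
      ∃ v < 0, HasDerivWithinAt (V i) v (Ici t) t) :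
    ∀ t, t₀ ≤ t → ∀ i, V i t ≤ c i := by
  intro b hb
  have hclosed : IsClosed ({t | ∀ i, V i t ≤ c i} ∩ Icc t₀ b) := by
    have : {t | ∀ i, V i t ≤ c i} ∩ Icc t₀ b = Icc t₀ b ∩ ⋂ i, Icc t₀ b ∩ V i ⁻¹' Iic (c i) := by
      ext t; simp only [mem_inter_iff, mem_ofPred_eq, mem_iInter, mem_preimage, mem_Iic]; grind
    rw [this]
    exact isClosed_Icc.inter (isClosed_iInter fun i =>
      ((hcont i).mono Icc_subset_Ici_self).preimage_isClosed_of_isClosed isClosed_Icc isClosed_Iic)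
  refine hclosed.Icc_subset_of_forall_mem_nhdsWithin h0 ?_ ⟨hb, le_rfl⟩
  rintro t ⟨ht, ht₀, -⟩
  refine eventually_all.2 fun i => ?_
  rcases (ht i).lt_or_eq with hlt | heq
  · have hright : Tendsto (V i) (𝓝[>] t) (𝓝 (V i t)) :=
      ((hcont i) t ht₀).mono fun s hs => ht₀.trans (le_of_lt hs)
    exact (hright.eventually_lt_const hlt).mono fun s hs => hs.le
  · obtain ⟨v, hv, hVi⟩ := hder t ht₀ ht i heq
    exact heq ▸ eventually_nhdsGT_le_of_hasDerivWithinAt_neg hVi hv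

theorem le_gronwallBound_of_hasDerivWithinAt {V : ℝ → ℝ} {t₀ R K b : ℝ}
    (hcont : ContinuousOn V (Ici t₀)) (h0 : V t₀ ≤ R)
    (hV : ∀ s, t₀ ≤ s → ∃ v ≤ K * V s + b, HasDerivWithinAt V v (Ici s) s)
    {t : ℝ} (ht : t₀ ≤ t) : V t ≤ gronwallBound R K b (t - t₀) := by
  choose! V' hle hV' using hV
  exact le_gronwallBound_of_liminf_deriv_right_le (hcont.mono Icc_subset_Ici_self)
    (fun s hs _ hr => (hV' s hs.1).liminf_right_slope_le hr) h0 (fun s hs => hle s hs.1)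
    t ⟨ht, le_rfl⟩

theorem eventually_le_of_hasDerivWithinAt_le {r c b ε : ℝ} (hr : 0 < r) (hc : 0 < c)
    (hb : b < c * ε) (R t₀ : ℝ) :
    ∀ᶠ t in atTop, ∀ V : ℝ → ℝ, ContinuousOn V (Ici t₀) → V t₀ ≤ R →
      (∀ s, t₀ ≤ s → ∃ v ≤ r * (b - c * V s), HasDerivWithinAt V v (Ici s) s) → V t ≤ ε := by
  have hrc : -(r * c) < 0 := neg_lt_zero.2 (mul_pos hr hc)
  have hlim : Tendsto (fun t => gronwallBound R (-(r * c)) (r * b) (t - t₀)) atTop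
      (𝓝 (R * 0 + r * b / -(r * c) * (0 - 1))) := by
    rw [gronwallBound_of_K_ne_0 hrc.ne]
    have hexp : Tendsto (fun t => Real.exp (-(r * c) * (t - t₀))) atTop (𝓝 0) :=
      Real.tendsto_exp_atBot.comp <|
        (tendsto_atTop_add_const_right _ (-t₀) tendsto_id).const_mul_atTop_of_neg hrc
    exact (hexp.const_mul _).add ((hexp.sub_const 1).const_mul _)
  have hlt : R * 0 + r * b / -(r * c) * (0 - 1) < ε := by
    have : R * 0 + r * b / -(r * c) * (0 - 1) = b / c := by field_simp; ring
    rwa [this, div_lt_iff₀' hc]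
  filter_upwards [hlim.eventually_lt_const hlt, eventually_ge_atTop t₀] with t ht htt₀ V hcont h0 hV
  refine (le_gronwallBound_of_hasDerivWithinAt hcont h0 (fun s hs => ?_) htt₀).trans ht.le
  obtain ⟨v, hv, hVs⟩ := hV s hs
  exact ⟨v, by linarith, hVs⟩

/-- Three nonnegative functions of time: a fast `E`, a fast `Q` driven by `E` and a slow `P` driven
by `Q`, with perturbations that vanish as the gains `θ` and `σ` grow. The differential inequalities
are only required while the functions are at most `R`; initially they are at most `M`. -/
structure IsCascade (c C L M R θ σ t₀ : ℝ) (E Q P : ℝ → ℝ) : Prop where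
  nonneg : ∀ t, 0 ≤ E t ∧ 0 ≤ Q t ∧ 0 ≤ P t
  continuousOn : ContinuousOn E (Ici t₀) ∧ ContinuousOn Q (Ici t₀) ∧ ContinuousOn P (Ici t₀)
  init_le : E t₀ ≤ M ∧ Q t₀ ≤ M ∧ P t₀ ≤ M
  deriv_E : ∀ t, t₀ ≤ t → E t ≤ R → Q t ≤ R → P t ≤ R →
    ∃ v ≤ σ * (L / σ ^ 4 - c * E t), HasDerivWithinAt E v (Ici t) t
  deriv_Q : ∀ t, t₀ ≤ t → E t ≤ R → Q t ≤ R → P t ≤ R →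
    ∃ v ≤ θ * (C * E t + L / θ ^ 2 - c * Q t), HasDerivWithinAt Q v (Ici t) t
  deriv_P : ∀ t, t₀ ≤ t → E t ≤ R → Q t ≤ R → P t ≤ R →
    ∃ v ≤ L * Q t + L / σ ^ 2 - c * P t, HasDerivWithinAt P v (Ici t) t

/-- The gains for which a cascade stays bounded and is eventually at most `ε`. -/
structure IsHighGain (c C L M ε θ σ : ℝ) : Prop where
  pos : 0 < θ ∧ 0 < σ
  fast_E : L / σ ^ 4 < c * M
  fast_Q : L / θ ^ 2 < c * M
  slow : L / c * ((1 + C / c) * M) / θ + C * L / c ^ 2 * M / σ ≤ 1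
  slow_deriv : L / σ ^ 2 + L / c * (L / θ ^ 2) + C * L / c ^ 2 * (L / σ ^ 4) < c * M
  ultimate_E : L / σ ^ 2 < c * ε
  ultimate_Q : C * ε / σ ^ 2 + L / θ ^ 2 < c * min ε (c * ε / (2 * L))
  ultimate_P : L / σ ^ 2 < c * ε / 2

variable {c C L M R ε θ σ t₀ : ℝ}

theorem eventually_isHighGain (hc : 0 < c) (hL : 0 < L) (hM : 0 < M) (hε : 0 < ε) (C : ℝ) :
    ∀ᶠ gain : ℝ × ℝ in atTop, IsHighGain c C L M ε gain.1 gain.2 := by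
  rw [← prod_atTop_atTop_eq]
  have hθ (b : ℝ) {n : ℕ} (hn : n ≠ 0) :
      Tendsto (fun gain : ℝ × ℝ => b / gain.1 ^ n) (atTop ×ˢ atTop) (𝓝 0) :=
    ((tendsto_pow_atTop hn).comp tendsto_fst).const_div_atTop b
  have hσ (b : ℝ) {n : ℕ} (hn : n ≠ 0) :
      Tendsto (fun gain : ℝ × ℝ => b / gain.2 ^ n) (atTop ×ˢ atTop) (𝓝 0) :=
    ((tendsto_pow_atTop hn).comp tendsto_snd).const_div_atTop b
  have hslow := (hθ (L / c * ((1 + C / c) * M)) one_ne_zero).add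
    (hσ (C * L / c ^ 2 * M) one_ne_zero)
  have hderiv := ((hσ L two_ne_zero).add ((hθ L two_ne_zero).const_mul (L / c))).add
    ((hσ L four_ne_zero).const_mul (C * L / c ^ 2))
  have hult := (hσ (C * ε) two_ne_zero).add (hθ L two_ne_zero)
  simp only [pow_one, mul_zero, add_zero] at hslow hderiv hult
  filter_upwards [tendsto_fst.eventually (eventually_gt_atTop 0),
    tendsto_snd.eventually (eventually_gt_atTop 0),
    (hσ L four_ne_zero).eventually_lt_const (mul_pos hc hM),
    (hθ L two_ne_zero).eventually_lt_const (mul_pos hc hM),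
    hslow.eventually_le_const one_pos, hderiv.eventually_lt_const (mul_pos hc hM),
    (hσ L two_ne_zero).eventually_lt_const (mul_pos hc hε),
    hult.eventually_lt_const (by positivity : 0 < c * min ε (c * ε / (2 * L))),
    (hσ L two_ne_zero).eventually_lt_const (half_pos (mul_pos hc hε))]
    with gain h₁ h₂ h₃ h₄ h₅ h₆ h₇ h₈ h₉
  exact ⟨⟨h₁, h₂⟩, h₃, h₄, h₅, h₆, h₇, h₈, h₉⟩

namespace IsCascade

variable {E Q P : ℝ → ℝ}

/-- The slow function, corrected so that the driving terms cancel in its derivative. -/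
def slowLyap (c C L θ σ : ℝ) (E Q P : ℝ → ℝ) (t : ℝ) : ℝ :=
  P t + L / c / θ * Q t + C * L / c ^ 2 / σ * E t

variable (hg : IsHighGain c C L M ε θ σ) (hc : 0 < c) (hC : 0 ≤ C) (hL : 0 ≤ L)

include hg hc hC hL

theorem exists_hasDerivWithinAt_slowLyap (h : IsCascade c C L M R θ σ t₀ E Q P)
    {t : ℝ} (ht : t₀ ≤ t) (hE : E t ≤ R) (hQ : Q t ≤ R) (hP : P t ≤ R) :
    ∃ v < c * (M - P t), HasDerivWithinAt (slowLyap c C L θ σ E Q P) v (Ici t) t := by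
  obtain ⟨e, he, hE'⟩ := h.deriv_E t ht hE hQ hP
  obtain ⟨q, hq, hQ'⟩ := h.deriv_Q t ht hE hQ hP
  obtain ⟨p, hp, hP'⟩ := h.deriv_P t ht hE hQ hP
  obtain ⟨hθ, hσ⟩ := hg.pos
  refine ⟨p + L / c / θ * q + C * L / c ^ 2 / σ * e, ?_,
    (hP'.add (hQ'.const_mul _)).add (hE'.const_mul _)⟩
  calc p + L / c / θ * q + C * L / c ^ 2 / σ * e
      ≤ (L * Q t + L / σ ^ 2 - c * P t)
        + L / c / θ * (θ * (C * E t + L / θ ^ 2 - c * Q t))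
        + C * L / c ^ 2 / σ * (σ * (L / σ ^ 4 - c * E t)) := by gcongr
    _ = L / σ ^ 2 + L / c * (L / θ ^ 2) + C * L / c ^ 2 * (L / σ ^ 4) - c * P t := by
      field_simp; ring
    _ < c * (M - P t) := by linarith [hg.slow_deriv]

theorem slowLyap_le_add_one {t : ℝ} (hE : E t ≤ M) (hQ : Q t ≤ (1 + C / c) * M) :
    slowLyap c C L θ σ E Q P t ≤ P t + 1 := by
  obtain ⟨hθ, hσ⟩ := hg.pos
  calc slowLyap c C L θ σ E Q P t
      ≤ P t + L / c / θ * ((1 + C / c) * M) + C * L / c ^ 2 / σ * M := by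
        unfold slowLyap; gcongr
    _ = P t + (L / c * ((1 + C / c) * M) / θ + C * L / c ^ 2 * M / σ) := by ring
    _ ≤ P t + 1 := by gcongr; exact hg.slow

theorem le_slowLyap (h : IsCascade c C L M R θ σ t₀ E Q P) (t : ℝ) :
    P t ≤ slowLyap c C L θ σ E Q P t := by
  obtain ⟨hθ, hσ⟩ := hg.pos
  obtain ⟨hE, hQ, -⟩ := h.nonneg t
  have hE' : 0 ≤ C * L / c ^ 2 / σ * E t := by positivity
  have hQ' : 0 ≤ L / c / θ * Q t := by positivity
  unfold slowLyap
  linarith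

theorem le_of_slowLyap_le (h : IsCascade c C L M R θ σ t₀ E Q P) (hM : 0 ≤ M)
    (hR : (1 + C / c) * M + 1 ≤ R) {t : ℝ} (hE : E t ≤ M) (hQ : Q t ≤ (1 + C / c) * M)
    (hW : slowLyap c C L θ σ E Q P t ≤ M + 1) : E t ≤ R ∧ Q t ≤ R ∧ P t ≤ R := by
  have hP := le_slowLyap hg hc hC hL h t
  have hCM : 0 ≤ C / c * M := by positivity
  refine ⟨?_, ?_, ?_⟩ <;> linarith

theorem le_of_isHighGain (h : IsCascade c C L M R θ σ t₀ E Q P) (hM : 0 ≤ M)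
    (hR : (1 + C / c) * M + 1 ≤ R) {t : ℝ} (ht : t₀ ≤ t) : E t ≤ R ∧ Q t ≤ R ∧ P t ≤ R := by
  obtain ⟨hθ, hσ⟩ := hg.pos
  obtain ⟨hE₀, hQ₀, hP₀⟩ := h.init_le
  obtain ⟨hEc, hQc, hPc⟩ := h.continuousOn
  have hQ₀' : Q t₀ ≤ (1 + C / c) * M :=
    hQ₀.trans (le_mul_of_one_le_left hM (le_add_of_nonneg_right (by positivity)))
  have key := forall_le_of_hasDerivWithinAt_neg
    (V := ![E, Q, slowLyap c C L θ σ E Q P]) (c := ![M, (1 + C / c) * M, M + 1]) (t₀ := t₀)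
    ?_ ?_ ?_ t ht
  · exact le_of_slowLyap_le hg hc hC hL h hM hR (key 0) (key 1) (key 2)
  · have hW : ContinuousOn (slowLyap c C L θ σ E Q P) (Ici t₀) :=
      (hPc.add (hQc.const_smul (L / c / θ))).add (hEc.const_smul (C * L / c ^ 2 / σ))
    simp [Fin.forall_fin_succ, hEc, hQc, hW]
  · have hW := slowLyap_le_add_one (P := P) hg hc hC hL hE₀ hQ₀'
    simpa [Fin.forall_fin_succ, hE₀, hQ₀'] using hW.trans (by linarith)
  · intro s hs hle
    have hEs : E s ≤ M := hle 0
    have hQs : Q s ≤ (1 + C / c) * M := hle 1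
    have hCE : C * E s ≤ C * M := by gcongr
    obtain ⟨hER, hQR, hPR⟩ := le_of_slowLyap_le hg hc hC hL h hM hR hEs hQs (hle 2)
    intro i hi
    fin_cases i
    · obtain ⟨v, hv, hE'⟩ := h.deriv_E s hs hER hQR hPR
      replace hi : E s = M := hi
      exact ⟨v, hv.trans_lt (mul_neg_of_pos_of_neg hσ (by linarith [hi ▸ hg.fast_E])), hE'⟩
    · obtain ⟨v, hv, hQ'⟩ := h.deriv_Q s hs hER hQR hPR
      replace hi : c * Q s = c * M + C * M := by
        rw [show Q s = (1 + C / c) * M from hi]; field_simp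
      exact ⟨v, hv.trans_lt (mul_neg_of_pos_of_neg hθ (by linarith [hg.fast_Q])), hQ'⟩
    · obtain ⟨v, hv, hW'⟩ :=
        exists_hasDerivWithinAt_slowLyap hg hc hC hL h hs hER hQR hPR
      have hW := slowLyap_le_add_one (P := P) hg hc hC hL hEs hQs
      replace hi : slowLyap c C L θ σ E Q P s = M + 1 := hi
      exact ⟨v, hv.trans_le (mul_nonpos_of_nonneg_of_nonpos hc.le (by linarith)), hW'⟩

end IsCascade

section UltimateBound

variable (hg : IsHighGain c C L M ε θ σ) (hc : 0 < c) (hC : 0 ≤ C) (hL : 0 < L) (hM : 0 ≤ M)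
  (hR : (1 + C / c) * M + 1 ≤ R) (t₀)

include hg hc hC hL hM hR

theorem eventually_isCascade_E_le :
    ∀ᶠ t in atTop, ∀ E Q P, IsCascade c C L M R θ σ t₀ E Q P → E t ≤ ε / σ ^ 2 := by
  obtain ⟨-, hσ⟩ := hg.pos
  have hlt : L / σ ^ 4 < c * (ε / σ ^ 2) :=
    calc L / σ ^ 4 = L / σ ^ 2 / σ ^ 2 := by field_simp
      _ < c * ε / σ ^ 2 := by gcongr; exact hg.ultimate_E
      _ = c * (ε / σ ^ 2) := by ring
  filter_upwards [eventually_le_of_hasDerivWithinAt_le hσ hc hlt M t₀] with t ht E Q P h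
  refine ht E h.continuousOn.1 h.init_le.1 fun s hs => ?_
  obtain ⟨hE, hQ, hP⟩ := h.le_of_isHighGain hg hc hC hL.le hM hR hs
  exact h.deriv_E s hs hE hQ hP

theorem eventually_isCascade_Q_le :
    ∀ᶠ t in atTop, ∀ E Q P, IsCascade c C L M R θ σ t₀ E Q P →
      Q t ≤ min ε (c * ε / (2 * L)) := by
  obtain ⟨hθ, -⟩ := hg.pos
  obtain ⟨T, hT⟩ := eventually_atTop.1
    ((eventually_isCascade_E_le t₀ hg hc hC hL hM hR).and (eventually_ge_atTop t₀))
  have hT₀ := (hT T le_rfl).2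
  filter_upwards [eventually_le_of_hasDerivWithinAt_le hθ hc hg.ultimate_Q R T] with t ht E Q P h
  have hle {s} (hs : T ≤ s) := h.le_of_isHighGain hg hc hC hL.le hM hR (hT₀.trans hs)
  refine ht Q (h.continuousOn.2.1.mono (Ici_subset_Ici.2 hT₀)) (hle le_rfl).2.1 fun s hs => ?_
  obtain ⟨v, hv, hQ'⟩ := h.deriv_Q s (hT₀.trans hs) (hle hs).1 (hle hs).2.1 (hle hs).2.2
  refine ⟨v, hv.trans ?_, hQ'⟩
  have hE : C * E s ≤ C * (ε / σ ^ 2) := by gcongr; exact (hT s hs).1 E Q P h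
  rw [mul_div_assoc]
  gcongr

theorem eventually_isCascade_P_le :
    ∀ᶠ t in atTop, ∀ E Q P, IsCascade c C L M R θ σ t₀ E Q P → P t ≤ ε := by
  obtain ⟨T, hT⟩ := eventually_atTop.1
    ((eventually_isCascade_Q_le t₀ hg hc hC hL hM hR).and (eventually_ge_atTop t₀))
  have hT₀ := (hT T le_rfl).2
  have hlt : c * ε / 2 + L / σ ^ 2 < c * ε := by linarith [hg.ultimate_P]
  filter_upwards [eventually_le_of_hasDerivWithinAt_le one_pos hc hlt R T] with t ht E Q P h
  have hle {s} (hs : T ≤ s) := h.le_of_isHighGain hg hc hC hL.le hM hR (hT₀.trans hs)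
  refine ht P (h.continuousOn.2.2.mono (Ici_subset_Ici.2 hT₀)) (hle le_rfl).2.2 fun s hs => ?_
  obtain ⟨v, hv, hP'⟩ := h.deriv_P s (hT₀.trans hs) (hle hs).1 (hle hs).2.1 (hle hs).2.2
  refine ⟨v, hv.trans ?_, hP'⟩
  have hQ : L * Q s ≤ c * ε / 2 :=
    calc L * Q s ≤ L * (c * ε / (2 * L)) := by
          gcongr; exact ((hT s hs).1 E Q P h).trans (min_le_right _ _)
      _ = c * ε / 2 := by field_simp
  linarith

end UltimateBound

section StronglyMonotoneMap

variable {E : Type*} [NormedAddCommGroup E] [InnerProductSpace ℝ E] {F : E → E} {m : ℝ}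
  (hF : ∀ x y, m * ‖x - y‖ ^ 2 ≤ inner ℝ (x - y) (F x - F y))

include hF

theorem antilipschitzWith_of_le_inner (hm : 0 < m) : AntilipschitzWith (Real.toNNReal m⁻¹) F := by
  refine AntilipschitzWith.of_le_mul_dist fun x y => ?_
  rw [dist_eq_norm, dist_eq_norm, Real.coe_toNNReal _ (inv_pos.2 hm).le, ← div_eq_inv_mul,
    le_div_iff₀' hm]
  rcases (norm_nonneg (x - y)).eq_or_lt with h0 | h0
  · simp [← h0]
  · refine le_of_mul_le_mul_left ?_ h0
    calc ‖x - y‖ * (m * ‖x - y‖) = m * ‖x - y‖ ^ 2 := by ring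
      _ ≤ ‖x - y‖ * ‖F x - F y‖ := (hF x y).trans (real_inner_le_norm _ _)

theorem mul_norm_sq_le_inner_fderiv {x : E} (hFx : DifferentiableAt ℝ F x) (v : E) :
    m * ‖v‖ ^ 2 ≤ inner ℝ v (fderiv ℝ F x v) := by
  have hlim := (hFx.hasFDerivAt.hasLineDerivAt v).tendsto_slope_zero
  refine ge_of_tendsto (tendsto_const_nhds.inner hlim) ?_
  filter_upwards [self_mem_nhdsWithin] with t (ht : t ≠ 0)
  have h := hF (x + t • v) x
  rw [add_sub_cancel_left, norm_smul, mul_pow, Real.norm_eq_abs, sq_abs, real_inner_smul_left] at h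
  rw [real_inner_smul_right, ← div_eq_inv_mul]
  calc m * ‖v‖ ^ 2 = m * (t ^ 2 * ‖v‖ ^ 2) / t ^ 2 := by field_simp
    _ ≤ t * inner ℝ v (F (x + t • v) - F x) / t ^ 2 := by gcongr
    _ = inner ℝ v (F (x + t • v) - F x) / t := by field_simp

theorem existsUnique_eq_zero_of_le_inner [FiniteDimensional ℝ E] (hm : 0 < m)
    (hdiff : Differentiable ℝ F) : ∃! x, F x = 0 := by
  have hanti := antilipschitzWith_of_le_inner hF hm
  have htend : Tendsto (fun x => ‖F x‖ ^ 2) (cocompact E) atTop := by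
    rw [← Metric.cobounded_eq_cocompact]
    exact (tendsto_pow_atTop two_ne_zero).comp
      (tendsto_norm_cobounded_atTop.comp hanti.tendsto_cobounded)
  obtain ⟨x, hx⟩ := (hdiff.continuous.norm.pow 2).exists_forall_le htend
  have hcrit : inner ℝ (F x) (fderiv ℝ F x (F x)) = 0 := by
    have h0 := IsLocalMin.hasFDerivAt_eq_zero (Eventually.of_forall hx)
      (hdiff x).hasFDerivAt.norm_sq
    simpa using DFunLike.congr_fun h0 (F x)
  have hFx : F x = 0 := by
    have hle := mul_norm_sq_le_inner_fderiv hF (hdiff x) (F x)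
    rw [hcrit] at hle
    simpa using le_antisymm (nonpos_of_mul_nonpos_right hle hm) (sq_nonneg _)
  exact ⟨x, hFx, fun y hy => hanti.injective (hy.trans hFx.symm)⟩

end StronglyMonotoneMap

section Nash

variable {N : ℕ} {f : Fin N → (Fin N → ℝ) → ℝ} {m : ℝ}

theorem contDiff_ownPartial (hf : ∀ i, ContDiff ℝ 2 (f i)) (i : Fin N) :
    ContDiff ℝ 1 (ownPartial f i) :=
  ((hf i).fderiv_right (m := 1) (by norm_num)).clm_apply contDiff_const

theorem StronglyMonotone.mul_sum_sq_le (h : StronglyMonotone f m) (x z : Fin N → ℝ) :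
    m * ∑ i, (x i - z i) ^ 2 ≤ ∑ i, (x i - z i) * (ownPartial f i x - ownPartial f i z) := by
  have := h x z
  rwa [EuclideanSpace.real_norm_sq_eq] at this

theorem hasDerivAt_comp_update {i : Fin N} (hf : Differentiable ℝ (f i)) (x : Fin N → ℝ) (r : ℝ) :
    HasDerivAt (fun s => f i (Function.update x i s)) (ownPartial f i (Function.update x i r)) r :=
  (hf (Function.update x i r)).hasFDerivAt.comp_hasDerivAt r (hasDerivAt_update x i r)

theorem StronglyMonotone.monotone_ownPartial_update (h : StronglyMonotone f m) (hm : 0 ≤ m)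
    (i : Fin N) (x : Fin N → ℝ) : Monotone fun r => ownPartial f i (Function.update x i r) := by
  intro r s hrs
  rcases hrs.eq_or_lt with rfl | hlt
  · rfl
  have hle := h.mul_sum_sq_le (Function.update x i s) (Function.update x i r)
  have hother (j) (hj : j ≠ i) : Function.update x i s j - Function.update x i r j = 0 := by
    simp [hj]
  rw [Fintype.sum_eq_single i fun j hj => by rw [hother j hj]; ring,
    Fintype.sum_eq_single i fun j hj => by rw [hother j hj]; ring] at hle
  simp only [Function.update_self] at hle
  have hsr := sub_pos.2 hlt
  exact sub_nonneg.1 (nonneg_of_mul_nonneg_right (hle.trans' (by positivity)) hsr)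

theorem StronglyMonotone.convexOn_update (h : StronglyMonotone f m) (hm : 0 ≤ m) {i : Fin N}
    (hf : Differentiable ℝ (f i)) (x : Fin N → ℝ) :
    ConvexOn ℝ univ fun r => f i (Function.update x i r) := by
  have hder := hasDerivAt_comp_update hf x
  refine Monotone.convexOn_univ_of_deriv (fun r => (hder r).differentiableAt) ?_
  rw [funext fun r => (hder r).deriv]
  exact h.monotone_ownPartial_update hm i x

theorem StronglyMonotone.isNash_iff_ownPartial_eq_zero (h : StronglyMonotone f m) (hm : 0 ≤ m)
    (hf : ∀ i, Differentiable ℝ (f i)) (x : Fin N → ℝ) :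
    IsNash f x ↔ ∀ i, ownPartial f i x = 0 := by
  refine forall_congr' fun i => ?_
  have hder := hasDerivAt_comp_update (hf i) x (x i)
  rw [Function.update_eq_self] at hder
  constructor
  · intro hmin
    exact IsLocalMin.hasDerivAt_eq_zero (Eventually.of_forall fun r => by simpa using hmin r) hder
  · intro h0 r
    have hright : derivWithin (fun r => f i (Function.update x i r)) (Ioi (x i)) (x i) = 0 :=
      (hder.hasDerivWithinAt.derivWithin (uniqueDiffWithinAt_Ioi _)).trans h0
    simpa using (h.convexOn_update hm (hf i) x).isMinOn_of_rightDeriv_eq_zero (by simp) hright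
      (mem_univ r)

theorem StronglyMonotone.existsUnique_isNash (h : StronglyMonotone f m) (hm : 0 < m)
    (hf : ∀ i, ContDiff ℝ 2 (f i)) : ∃! x, IsNash f x := by
  let F (x : EuclideanSpace ℝ (Fin N)) : EuclideanSpace ℝ (Fin N) :=
    WithLp.toLp 2 (pseudoGradient f x.ofLp)
  have hF (x y) : m * ‖x - y‖ ^ 2 ≤ inner ℝ (x - y) (F x - F y) := by
    rw [real_inner_comm]
    simpa [EuclideanSpace.inner_eq_star_dotProduct, F] using h x.ofLp y.ofLp
  have hdiff : Differentiable ℝ F :=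
    differentiable_euclidean.2 fun i =>
      ((contDiff_ownPartial hf i).differentiable one_ne_zero).comp
        (PiLp.continuousLinearEquiv 2 ℝ fun _ : Fin N => ℝ).differentiable
  obtain ⟨x, hx, huniq⟩ := existsUnique_eq_zero_of_le_inner hF hm hdiff
  have hzero (y : EuclideanSpace ℝ (Fin N)) : F y = 0 ↔ IsNash f y.ofLp := by
    rw [h.isNash_iff_ownPartial_eq_zero hm.le fun i => (hf i).differentiable two_ne_zero,
      WithLp.toLp_eq_zero]
    exact funext_iff
  exact ⟨x.ofLp, (hzero x).1 hx, fun y hy =>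
    congr_arg WithLp.ofLp (huniq (WithLp.toLp 2 y) ((hzero _).2 hy))⟩

end Nash

section Coercivity

/-- A continuous function that is homogeneous of degree two, for instance a quadratic form. -/
structure IsSqHomogeneous {V : Type*} [NormedAddCommGroup V] [NormedSpace ℝ V] (φ : V → ℝ) :
    Prop where
  continuous : Continuous φ
  smul : ∀ (r : ℝ) v, φ (r • v) = r ^ 2 * φ v

namespace IsSqHomogeneous

variable {V : Type*} [NormedAddCommGroup V] [NormedSpace ℝ V] {φ ψ : V → ℝ}

theorem norm_sq (V : Type*) [NormedAddCommGroup V] [NormedSpace ℝ V] :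
    IsSqHomogeneous fun v : V => ‖v‖ ^ 2 :=
  ⟨by fun_prop, fun r v => by rw [norm_smul, mul_pow, Real.norm_eq_abs, sq_abs]⟩

theorem map_zero (hφ : IsSqHomogeneous φ) : φ 0 = 0 := by
  simpa using hφ.smul 0 0

theorem nonneg (hφ : IsSqHomogeneous φ) (hpos : ∀ v ≠ 0, 0 < φ v) (v : V) : 0 ≤ φ v := by
  rcases eq_or_ne v 0 with rfl | hv
  · exact hφ.map_zero.ge
  · exact (hpos v hv).le

theorem exists_le_mul [FiniteDimensional ℝ V] (hφ : IsSqHomogeneous φ) (hψ : IsSqHomogeneous ψ)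
    (hpos : ∀ v ≠ 0, 0 < ψ v) : ∃ C > 0, ∀ v, φ v ≤ C * ψ v := by
  have hsphere : ∀ u ∈ Metric.sphere (0 : V) 1, 0 < ψ u := fun u hu =>
    hpos u (ne_zero_of_mem_unit_sphere ⟨u, hu⟩)
  obtain ⟨C, hC⟩ := (isCompact_sphere (0 : V) 1).exists_bound_of_continuousOn
    (hφ.continuous.continuousOn.div hψ.continuous.continuousOn fun u hu => (hsphere u hu).ne')
  refine ⟨max C 1, by positivity, fun v => ?_⟩
  rcases eq_or_ne v 0 with rfl | hv
  · rw [hφ.map_zero, hψ.map_zero, mul_zero]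
  set u := ‖v‖⁻¹ • v
  have hu : u ∈ Metric.sphere (0 : V) 1 := by simp [u, norm_smul, norm_ne_zero_iff.2 hv]
  have hle : φ u ≤ max C 1 * ψ u :=
    (div_le_iff₀ (hsphere u hu)).1 ((le_abs_self _).trans ((hC u hu).trans (le_max_left _ _)))
  have hvu : v = ‖v‖ • u := by simp [u, smul_smul, norm_ne_zero_iff.2 hv]
  calc φ v = ‖v‖ ^ 2 * φ u := by rw [← hφ.smul, ← hvu]
    _ ≤ ‖v‖ ^ 2 * (max C 1 * ψ u) := by gcongr
    _ = max C 1 * ψ v := by rw [mul_left_comm, ← hψ.smul, ← hvu]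

theorem isBounded_setOf_le [FiniteDimensional ℝ V] (hφ : IsSqHomogeneous φ)
    (hpos : ∀ v ≠ 0, 0 < φ v) (R : ℝ) : Bornology.IsBounded {v | φ v ≤ R} := by
  obtain ⟨C, hC, hle⟩ := (norm_sq V).exists_le_mul hφ hpos
  exact isBounded_iff_forall_norm_le.2
    ⟨√(C * R), fun v hv => Real.le_sqrt_of_sq_le ((hle v).trans (by gcongr; exact hv))⟩

end IsSqHomogeneous

theorem exists_pos_forall_le {ι : Type*} [Finite ι] {c : ι → ℝ} (hc : ∀ i, 0 < c i) :
    ∃ r > 0, ∀ i, r ≤ c i :=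
  ((eventually_mem_nhdsWithin (a := (0 : ℝ)) (s := Ioi 0)).and
    (eventually_all.2 fun i => (eventually_le_nhds (hc i)).filter_mono nhdsWithin_le_nhds)).exists

end Coercivity

section Graph

/-- The Laplacian of the weighted graph `a`, pinned at the neighbours of the node `j`: the matrix
through which the players' estimates of `x j` flow. -/
def pinnedLaplacian {ι : Type*} [Fintype ι] (a : Matrix ι ι ℝ) (j : ι) (v : ι → ℝ) (i : ι) : ℝ :=
  (∑ k, a i k * (v i - v k)) + a i j * v i

theorem pinnedLaplacian_smul {ι : Type*} [Fintype ι] (a : Matrix ι ι ℝ) (j : ι) (r : ℝ)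
    (v : ι → ℝ) (i : ι) : pinnedLaplacian a j (r • v) i = r * pinnedLaplacian a j v i := by
  have hsum : ∑ k, a i k * (r * v i - r * v k) = r * ∑ k, a i k * (v i - v k) := by
    rw [Finset.mul_sum]
    exact Finset.sum_congr rfl fun k _ => by ring
  simp only [pinnedLaplacian, Pi.smul_apply, smul_eq_mul, hsum]
  ring

theorem sum_mul_pinnedLaplacian {ι : Type*} [Fintype ι] {a : Matrix ι ι ℝ} (ha : a.IsSymm) (j : ι)
    (v : ι → ℝ) : ∑ i, v i * pinnedLaplacian a j v i =
      (∑ i, ∑ k, a i k * (v i - v k) ^ 2) / 2 + ∑ i, a i j * v i ^ 2 := by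
  have hswap : ∑ i, ∑ k, v i * (a i k * (v i - v k)) = ∑ i, ∑ k, v k * (a i k * (v k - v i)) := by
    rw [Finset.sum_comm]
    simp only [ha.apply]
  have hsq : ∑ i, ∑ k, a i k * (v i - v k) ^ 2 =
      ∑ i, ∑ k, v i * (a i k * (v i - v k)) + ∑ i, ∑ k, v k * (a i k * (v k - v i)) := by
    simp only [← Finset.sum_add_distrib]
    congr! 2
    ring
  have hform : ∑ i, v i * pinnedLaplacian a j v i =
      ∑ i, ∑ k, v i * (a i k * (v i - v k)) + ∑ i, a i j * v i ^ 2 := by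
    simp only [← Finset.sum_add_distrib, pinnedLaplacian, mul_add, Finset.mul_sum]
    congr! 2
    ring
  rw [hform, hsq, ← hswap]
  ring

namespace IsUndirectedConnected

variable {N : ℕ} {a : Matrix (Fin N) (Fin N) ℝ}

theorem isSymm (ha : IsUndirectedConnected a) : a.IsSymm :=
  Matrix.IsSymm.ext fun i j => ha.symm j i

theorem pos_of_adj (ha : IsUndirectedConnected a) {i k : Fin N}
    (h : (SimpleGraph.fromRel fun i j => 0 < a i j).Adj i k) : 0 < a i k := by
  rw [SimpleGraph.fromRel_adj, ha.symm k i, or_self] at h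
  exact h.2

theorem eq_of_forall_pos (ha : IsUndirectedConnected a) {v : Fin N → ℝ}
    (hv : ∀ i k, 0 < a i k → v i = v k) (i k : Fin N) : v i = v k := by
  have hik := ha.connected.preconnected i k
  rw [SimpleGraph.reachable_iff_reflTransGen] at hik
  induction hik with
  | refl => rfl
  | tail _ hadj ih => exact ih.trans (hv _ _ (ha.pos_of_adj hadj))

theorem sum_mul_pinnedLaplacian_pos (ha : IsUndirectedConnected a) (hN : 2 ≤ N) (j : Fin N)
    {v : Fin N → ℝ} (hv : v ≠ 0) : 0 < ∑ i, v i * pinnedLaplacian a j v i := by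
  have hedge (i k) : 0 ≤ a i k * (v i - v k) ^ 2 := mul_nonneg (ha.nonneg i k) (sq_nonneg _)
  have hpin (i) : 0 ≤ a i j * v i ^ 2 := mul_nonneg (ha.nonneg i j) (sq_nonneg _)
  have hrow (i) : 0 ≤ ∑ k, a i k * (v i - v k) ^ 2 := Finset.sum_nonneg fun k _ => hedge i k
  have hsum₁ := Finset.sum_nonneg fun i (_ : i ∈ Finset.univ) => hrow i
  have hsum₂ := Finset.sum_nonneg fun i (_ : i ∈ Finset.univ) => hpin i
  rw [sum_mul_pinnedLaplacian ha.isSymm]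
  refine (add_nonneg (div_nonneg hsum₁ zero_le_two) hsum₂).lt_of_ne' fun h0 => hv ?_
  obtain ⟨hzero₁, hzero₂⟩ := (add_eq_zero_iff_of_nonneg (div_nonneg hsum₁ zero_le_two) hsum₂).1 h0
  rw [div_eq_zero_iff, or_iff_left two_ne_zero, Fintype.sum_eq_zero_iff_of_nonneg hrow] at hzero₁
  rw [Fintype.sum_eq_zero_iff_of_nonneg hpin] at hzero₂
  have hconst := ha.eq_of_forall_pos (v := v) fun i k hik => by
    have h := congr_fun ((Fintype.sum_eq_zero_iff_of_nonneg (hedge i)).1 (congr_fun hzero₁ i)) k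
    exact sub_eq_zero.1 (pow_eq_zero_iff two_ne_zero |>.1
      ((mul_eq_zero.1 h).resolve_left hik.ne'))
  have : Nontrivial (Fin N) := Fin.nontrivial_iff_two_le.2 hN
  obtain ⟨i, hji⟩ := ha.connected.preconnected.exists_adj_of_nontrivial j
  have hvi : v i = 0 := pow_eq_zero_iff two_ne_zero |>.1
    ((mul_eq_zero.1 (congr_fun hzero₂ i)).resolve_left (ha.pos_of_adj hji.symm).ne')
  exact funext fun k => (hconst k i).trans hvi

theorem exists_mul_sum_sq_le (ha : IsUndirectedConnected a) (hN : 2 ≤ N) :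
    ∃ r > 0, ∀ j (v : Fin N → ℝ), r * ∑ i, v i ^ 2 ≤ ∑ i, v i * pinnedLaplacian a j v i := by
  have hcoercive (j) : ∃ C > 0, ∀ v : Fin N → ℝ,
      ∑ i, v i ^ 2 ≤ C * ∑ i, v i * pinnedLaplacian a j v i := by
    refine IsSqHomogeneous.exists_le_mul ⟨by fun_prop, fun r v => ?_⟩
      ⟨by unfold pinnedLaplacian; fun_prop, fun r v => ?_⟩
      fun v hv => ha.sum_mul_pinnedLaplacian_pos hN j hv
    · simp only [Pi.smul_apply, smul_eq_mul, mul_pow, Finset.mul_sum]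
    · simp only [Pi.smul_apply, smul_eq_mul, pinnedLaplacian_smul, Finset.mul_sum]
      exact Finset.sum_congr rfl fun i _ => by ring
  choose C hC hle using hcoercive
  obtain ⟨r, hr, hrC⟩ := exists_pos_forall_le fun j => inv_pos.2 (hC j)
  refine ⟨r, hr, fun j v => ?_⟩
  calc r * ∑ i, v i ^ 2 ≤ (C j)⁻¹ * ∑ i, v i ^ 2 := by gcongr; exact hrC j
    _ ≤ ∑ i, v i * pinnedLaplacian a j v i := (inv_mul_le_iff₀ (hC j)).2 (hle j v)

end IsUndirectedConnected

end Graph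

section ODE

variable {E : Type*} [NormedAddCommGroup E] [NormedSpace ℝ E]

theorem exists_lipschitzWith_bounded_eqOn [FiniteDimensional ℝ E] {F : Type*}
    [NormedAddCommGroup F] [NormedSpace ℝ F] {φ : E → F} (hφ : ContDiff ℝ 1 φ) {s : Set E}
    (hs : Bornology.IsBounded s) :
    ∃ (ψ : E → F) (K : NNReal) (L : ℝ), LipschitzWith K ψ ∧ (∀ x, ‖ψ x‖ ≤ L) ∧ EqOn ψ φ s := by
  obtain ⟨R, hR, hsR⟩ := hs.subset_closedBall_lt 0 0
  let χ : ContDiffBump (0 : E) := ⟨R, R + 1, hR, lt_add_one R⟩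
  have hsupp : HasCompactSupport fun x => χ x • φ x := χ.hasCompactSupport.smul_right
  have hsmooth : ContDiff ℝ 1 fun x => χ x • φ x := χ.contDiff.smul hφ
  obtain ⟨K, hK⟩ := hsmooth.lipschitzWith_of_hasCompactSupport hsupp one_ne_zero
  obtain ⟨L, hL⟩ := hsupp.exists_bound_of_continuous hsmooth.continuous
  exact ⟨_, K, L, hK, hL, fun x hx => by simp [χ.one_of_mem_closedBall (hsR hx)]⟩

variable {F : ℝ → E → E} {K : NNReal} {t₀ : ℝ} (hlip : ∀ t, t₀ ≤ t → LipschitzWith K (F t))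

include hlip

theorem eqOn_Icc_of_hasDerivWithinAt {γ₁ γ₂ : ℝ → E} {b : ℝ}
    (h₁ : ∀ t ∈ Icc t₀ b, HasDerivWithinAt γ₁ (F t (γ₁ t)) (Icc t₀ b) t)
    (h₂ : ∀ t ∈ Icc t₀ b, HasDerivWithinAt γ₂ (F t (γ₂ t)) (Icc t₀ b) t)
    (h0 : γ₁ t₀ = γ₂ t₀) : EqOn γ₁ γ₂ (Icc t₀ b) := by
  have hright {γ : ℝ → E} (h : ∀ t ∈ Icc t₀ b, HasDerivWithinAt γ (F t (γ t)) (Icc t₀ b) t) :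
      ∀ t ∈ Ico t₀ b, HasDerivWithinAt γ (F t (γ t)) (Ici t) t := fun t ht =>
    (h t (Ico_subset_Icc_self ht)).mono_of_mem_nhdsWithin (Icc_mem_nhdsGE_of_mem ht)
  exact ODE_solution_unique_of_mem_Icc_right (s := fun _ => univ)
    (fun t ht => (hlip t ht.1).lipschitzOnWith)
    (fun t ht => (h₁ t ht).continuousWithinAt) (hright h₁) (fun _ _ => mem_univ _)
    (fun t ht => (h₂ t ht).continuousWithinAt) (hright h₂) (fun _ _ => mem_univ _) h0

variable [CompleteSpace E] {L : ℝ} (hcont : ∀ x, ContinuousOn (fun t => F t x) (Ici t₀))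
  (hbdd : ∀ t, t₀ ≤ t → ∀ x, ‖F t x‖ ≤ L)

include hcont hbdd

theorem exists_hasDerivWithinAt_Icc (x₀ : E) {b : ℝ} (hb : t₀ ≤ b) :
    ∃ γ : ℝ → E, γ t₀ = x₀ ∧ ∀ t ∈ Icc t₀ b, HasDerivWithinAt γ (F t (γ t)) (Icc t₀ b) t := by
  have hPL : IsPicardLindelof F (tmin := t₀) (tmax := b) ⟨t₀, le_rfl, hb⟩ x₀
      (L.toNNReal * (b - t₀).toNNReal) 0 L.toNNReal K :=
    { lipschitzOnWith := fun t ht => (hlip t ht.1).lipschitzOnWith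
      continuousOn := fun x _ => (hcont x).mono Icc_subset_Ici_self
      norm_le := fun t ht x _ => (hbdd t ht.1 x).trans (Real.le_coe_toNNReal L)
      mul_max_le := by simp [hb] }
  exact hPL.exists_eq_forall_mem_Icc_hasDerivWithinAt₀

theorem exists_hasDerivWithinAt_Ici (x₀ : E) :
    ∃ γ : ℝ → E, γ t₀ = x₀ ∧ ∀ t, t₀ ≤ t → HasDerivWithinAt γ (F t (γ t)) (Ici t₀) t := by
  choose γ hγ₀ hγ using fun n : ℕ => exists_hasDerivWithinAt_Icc hlip hcont hbdd x₀
    (le_add_of_nonneg_right n.cast_nonneg : t₀ ≤ t₀ + n)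
  have hagree {n m : ℕ} {t : ℝ} (ht : t₀ ≤ t) (hn : t ≤ t₀ + n) (hm : t ≤ t₀ + m) :
      γ n t = γ m t := by
    have hrestrict {k : ℕ} (hk : t ≤ t₀ + k) :
        ∀ s ∈ Icc t₀ t, HasDerivWithinAt (γ k) (F s (γ k s)) (Icc t₀ t) s := fun s hs =>
      (hγ k s (Icc_subset_Icc_right hk hs)).mono (Icc_subset_Icc_right hk)
    exact eqOn_Icc_of_hasDerivWithinAt hlip (hrestrict hn) (hrestrict hm)
      ((hγ₀ n).trans (hγ₀ m).symm) ⟨ht, le_rfl⟩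
  have hceil (t : ℝ) : t ≤ t₀ + ⌈t - t₀⌉₊ := by linarith [Nat.le_ceil (t - t₀)]
  refine ⟨fun t => γ ⌈t - t₀⌉₊ t, hγ₀ _, fun t ht => ?_⟩
  obtain ⟨n, hn⟩ := exists_nat_gt (t - t₀)
  have htn : t < t₀ + n := by linarith
  have hglue : EqOn (fun s => γ ⌈s - t₀⌉₊ s) (γ n) (Icc t₀ (t₀ + n)) := fun s hs =>
    hagree hs.1 (hceil s) hs.2
  have hder := (hγ n t ⟨ht, htn.le⟩).congr hglue (hglue ⟨ht, htn.le⟩)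
  rw [← hglue ⟨ht, htn.le⟩] at hder
  refine hder.mono_of_mem_nhdsWithin ?_
  rw [← Ici_inter_Iic]
  exact inter_mem self_mem_nhdsWithin (mem_nhdsWithin_of_mem_nhds (Iic_mem_nhds htn))

end ODE

theorem sum_sq_le_of_norm_le {ι : Type*} [Fintype ι] {w : ι → ℝ} {B : ℝ} (hw : ‖w‖ ≤ B) :
    ∑ i, w i ^ 2 ≤ Fintype.card ι * B ^ 2 := by
  rw [← nsmul_eq_mul]
  refine Finset.sum_le_card_nsmul _ _ _ fun i _ => ?_
  exact sq_le_sq' (abs_le.1 ((norm_le_pi_norm w i).trans hw)).1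
    (abs_le.1 ((norm_le_pi_norm w i).trans hw)).2

theorem exists_apply_ne_zero {ι : Type*} {e : (ι → ℝ) × (ι → ℝ)} (he : e ≠ 0) :
    ∃ i, e.1 i ≠ 0 ∨ e.2 i ≠ 0 := by
  contrapose! he
  exact Prod.ext (funext fun i => (he i).1) (funext fun i => (he i).2)

section Observer

variable {ι : Type*} [Fintype ι] {k₁ k₂ : ι → ℝ}

/-- The error dynamics of the observers, for `e = (x - x̂, (d - ẑ) / σ)` and `w = ḋ`. -/
def observerField (k₁ k₂ : ι → ℝ) (σ : ℝ) (w : ι → ℝ) (e : (ι → ℝ) × (ι → ℝ)) :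
    (ι → ℝ) × (ι → ℝ) :=
  (fun i => σ * (e.2 i - k₁ i * e.1 i), fun i => w i / σ - σ * k₂ i * e.1 i)

/-- The Lyapunov function of the observer errors: a multiple of the solution `P` of
`Aᵀ P + P A = - diag (k₂, 1)` for the observer matrix `A = [[-k₁, 1], [-k₂, 0]]`. -/
def lyapE (k₁ k₂ : ι → ℝ) (e : (ι → ℝ) × (ι → ℝ)) : ℝ :=
  ∑ i, ((2 * k₂ i * e.1 i - k₁ i * e.2 i) ^ 2 + (4 * k₂ i + k₁ i ^ 2) * e.2 i ^ 2)

theorem isSqHomogeneous_lyapE (k₁ k₂ : ι → ℝ) : IsSqHomogeneous (lyapE k₁ k₂) := by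
  refine ⟨by unfold lyapE; fun_prop, fun r e => ?_⟩
  simp only [lyapE, Prod.smul_fst, Prod.smul_snd, Pi.smul_apply, smul_eq_mul, Finset.mul_sum]
  exact Finset.sum_congr rfl fun i _ => by ring

theorem lyapE_pos (k₁ : ι → ℝ) (hk₂ : ∀ i, 0 < k₂ i) {e : (ι → ℝ) × (ι → ℝ)} (he : e ≠ 0) :
    0 < lyapE k₁ k₂ e := by
  obtain ⟨i, hi⟩ := exists_apply_ne_zero he
  refine Finset.sum_pos' (fun i _ => by have := hk₂ i; positivity) ⟨i, Finset.mem_univ i, ?_⟩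
  have := hk₂ i
  rcases eq_or_ne (e.2 i) 0 with h₂ | h₂
  · have h₁ := hi.resolve_right (not_not.2 h₂)
    simp only [h₂, mul_zero, sub_zero]
    positivity
  · positivity

theorem hasDerivWithinAt_lyapE {γ : ℝ → (ι → ℝ) × (ι → ℝ)} {σ t : ℝ} {w : ι → ℝ} {s : Set ℝ}
    (hγ : HasDerivWithinAt γ (observerField k₁ k₂ σ w (γ t)) s t) :
    HasDerivWithinAt (fun τ => lyapE k₁ k₂ (γ τ))
      (∑ i, (2 * ((4 * k₂ i + 2 * k₁ i ^ 2) * (γ t).2 i - 2 * k₁ i * k₂ i * (γ t).1 i) * (w i / σ)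
        - σ * (4 * k₁ i * k₂ i * (k₂ i * (γ t).1 i ^ 2 + (γ t).2 i ^ 2)))) s t := by
  have h₁ (i) := hasDerivWithinAt_pi.1 hγ.fst i
  have h₂ (i) := hasDerivWithinAt_pi.1 hγ.snd i
  refine (HasDerivWithinAt.fun_sum fun i _ => ((((h₁ i).const_mul (2 * k₂ i)).fun_sub
    ((h₂ i).const_mul (k₁ i))).fun_pow 2).fun_add
    (((h₂ i).fun_pow 2).const_mul (4 * k₂ i + k₁ i ^ 2))).congr_deriv
    (Finset.sum_congr rfl fun i _ => ?_)
  simp only [observerField]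
  ring

/-- The rate at which `lyapE` decays along `observerField` when `σ = 1` and `w = 0`. -/
def dissE (k₁ k₂ : ι → ℝ) (e : (ι → ℝ) × (ι → ℝ)) : ℝ :=
  ∑ i, 4 * k₁ i * k₂ i * (k₂ i * e.1 i ^ 2 + e.2 i ^ 2)

theorem isSqHomogeneous_dissE (k₁ k₂ : ι → ℝ) : IsSqHomogeneous (dissE k₁ k₂) := by
  refine ⟨by unfold dissE; fun_prop, fun r e => ?_⟩
  simp only [dissE, Prod.smul_fst, Prod.smul_snd, Pi.smul_apply, smul_eq_mul, Finset.mul_sum]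
  exact Finset.sum_congr rfl fun i _ => by ring

theorem dissE_pos (hk₁ : ∀ i, 0 < k₁ i) (hk₂ : ∀ i, 0 < k₂ i) {e : (ι → ℝ) × (ι → ℝ)}
    (he : e ≠ 0) : 0 < dissE k₁ k₂ e := by
  obtain ⟨i, hi⟩ := exists_apply_ne_zero he
  refine Finset.sum_pos' (fun i _ => by have := hk₁ i; have := hk₂ i; positivity)
    ⟨i, Finset.mem_univ i, ?_⟩
  have := hk₁ i
  have := hk₂ i
  rcases hi with hi | hi <;> positivity

theorem exists_hasDerivWithinAt_lyapE_le (hk₁ : ∀ i, 0 < k₁ i) (hk₂ : ∀ i, 0 < k₂ i) (B : ℝ) :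
    ∃ c > 0, ∃ L, ∀ (γ : ℝ → (ι → ℝ) × (ι → ℝ)) w σ s t, 0 < σ → ‖w‖ ≤ B →
      HasDerivWithinAt γ (observerField k₁ k₂ σ w (γ t)) s t →
      ∃ v ≤ σ * (L / σ ^ 4 - c * lyapE k₁ k₂ (γ t)),
        HasDerivWithinAt (fun τ => lyapE k₁ k₂ (γ τ)) v s t := by
  let ℓ (e : (ι → ℝ) × (ι → ℝ)) (i : ι) :=
    (4 * k₂ i + 2 * k₁ i ^ 2) * e.2 i - 2 * k₁ i * k₂ i * e.1 i
  have hℓ : IsSqHomogeneous fun e => ∑ i, ℓ e i ^ 2 := by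
    refine ⟨by fun_prop, fun r e => ?_⟩
    simp only [ℓ, Prod.smul_fst, Prod.smul_snd, Pi.smul_apply, smul_eq_mul, Finset.mul_sum]
    exact Finset.sum_congr rfl fun i _ => by ring
  have hD := isSqHomogeneous_dissE k₁ k₂
  obtain ⟨C₁, hC₁, hℓD⟩ := hℓ.exists_le_mul hD fun e => dissE_pos hk₁ hk₂
  obtain ⟨C₂, hC₂, hED⟩ := (isSqHomogeneous_lyapE k₁ k₂).exists_le_mul hD
    fun e => dissE_pos hk₁ hk₂
  refine ⟨1 / (2 * C₂), by positivity, Fintype.card ι * B ^ 2 * (2 * C₁),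
    fun γ w σ s t hσ hw hγ => ⟨_, ?_, hasDerivWithinAt_lyapE hγ⟩⟩
  set e := γ t
  have hyoung (i) : 2 * ℓ e i * (w i / σ) ≤ σ / (2 * C₁) * ℓ e i ^ 2 + w i ^ 2 * (2 * C₁ / σ ^ 3) :=
    (two_mul_le_mul_sq_add_sq_div (by positivity : 0 < σ / (2 * C₁)) _ _).trans_eq
      (by field_simp)
  calc ∑ i, (2 * ℓ e i * (w i / σ) - σ * (4 * k₁ i * k₂ i * (k₂ i * e.1 i ^ 2 + e.2 i ^ 2)))
      ≤ ∑ i, (σ / (2 * C₁) * ℓ e i ^ 2 + w i ^ 2 * (2 * C₁ / σ ^ 3)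
        - σ * (4 * k₁ i * k₂ i * (k₂ i * e.1 i ^ 2 + e.2 i ^ 2))) := by
        gcongr with i; exact hyoung i
    _ = σ / (2 * C₁) * ∑ i, ℓ e i ^ 2 + (∑ i, w i ^ 2) * (2 * C₁ / σ ^ 3) - σ * dissE k₁ k₂ e := by
        rw [Finset.sum_sub_distrib, Finset.sum_add_distrib, dissE, Finset.mul_sum, Finset.mul_sum,
          Finset.sum_mul]
    _ ≤ σ / (2 * C₁) * (C₁ * dissE k₁ k₂ e) + Fintype.card ι * B ^ 2 * (2 * C₁ / σ ^ 3)
        - σ * dissE k₁ k₂ e := by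
        gcongr
        exacts [hℓD e, sum_sq_le_of_norm_le hw]
    _ = σ * (Fintype.card ι * B ^ 2 * (2 * C₁) / σ ^ 4 - 1 / (2 * C₂) * (C₂ * dissE k₁ k₂ e)) := by
        field_simp
        ring
    _ ≤ σ * (Fintype.card ι * B ^ 2 * (2 * C₁) / σ ^ 4 - 1 / (2 * C₂) * lyapE k₁ k₂ e) := by
        gcongr
        exact hED e

end Observer

section Consensus

variable {ι : Type*} [Fintype ι] {a : Matrix ι ι ℝ} {θbar : ι → ι → ℝ}

/-- The dynamics of the estimation errors `q i j` of a moving target whose coordinate `j` has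
velocity `u j` and is observed by the neighbours of `j` with offset `ℓ j`. -/
def consensusField (a : Matrix ι ι ℝ) (θbar : ι → ι → ℝ) (θ : ℝ) (ℓ u : ι → ℝ) (q : ι → ι → ℝ) :
    ι → ι → ℝ :=
  fun i j => -(θ * θbar i j) * (pinnedLaplacian a j (fun k => q k j) i - a i j * ℓ j) - u j

/-- The Lyapunov function of the estimation errors. -/
def lyapQ (θbar : ι → ι → ℝ) (q : ι → ι → ℝ) : ℝ :=
  ∑ i, ∑ j, q i j ^ 2 / θbar i j

theorem isSqHomogeneous_lyapQ (θbar : ι → ι → ℝ) : IsSqHomogeneous (lyapQ θbar) := by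
  refine ⟨by unfold lyapQ; fun_prop, fun r q => ?_⟩
  simp only [lyapQ, Pi.smul_apply, smul_eq_mul, Finset.mul_sum, mul_pow, mul_div_assoc]

theorem lyapQ_pos (hθbar : ∀ i j, 0 < θbar i j) {q : ι → ι → ℝ} (hq : q ≠ 0) :
    0 < lyapQ θbar q := by
  obtain ⟨i, hi⟩ := Function.ne_iff.1 hq
  obtain ⟨j, hj⟩ := Function.ne_iff.1 hi
  have hterm (i j) : 0 ≤ q i j ^ 2 / θbar i j := by have := hθbar i j; positivity
  refine Finset.sum_pos' (fun i _ => Finset.sum_nonneg fun j _ => hterm i j)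
    ⟨i, Finset.mem_univ i, Finset.sum_pos' (fun j _ => hterm i j) ⟨j, Finset.mem_univ j, ?_⟩⟩
  exact div_pos (sq_pos_of_ne_zero hj) (hθbar i j)

theorem hasDerivWithinAt_lyapQ (hθbar : ∀ i j, 0 < θbar i j) {γ : ℝ → ι → ι → ℝ} {θ t : ℝ}
    {ℓ u : ι → ℝ} {s : Set ℝ} (hγ : HasDerivWithinAt γ (consensusField a θbar θ ℓ u (γ t)) s t) :
    HasDerivWithinAt (fun τ => lyapQ θbar (γ τ))
      (∑ i, ∑ j, (θ * (2 * γ t i j * (a i j * ℓ j)) + 2 * γ t i j * (-(θbar i j)⁻¹ * u j)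
        - 2 * θ * (γ t i j * pinnedLaplacian a j (fun k => γ t k j) i))) s t := by
  have h (i j) := hasDerivWithinAt_pi.1 (hasDerivWithinAt_pi.1 hγ i) j
  refine (HasDerivWithinAt.fun_sum fun i _ => HasDerivWithinAt.fun_sum fun j _ =>
    ((h i j).fun_pow 2).div_const (θbar i j)).congr_deriv
    (Finset.sum_congr rfl fun i _ => Finset.sum_congr rfl fun j _ => ?_)
  have := hθbar i j
  simp only [consensusField]
  field_simp
  ring

theorem exists_sum_sum_mul_sq_le (b : ι → ι → ℝ) :
    ∃ C > 0, ∀ ℓ : ι → ℝ, ∑ i, ∑ j, (b i j * ℓ j) ^ 2 ≤ C * ‖ℓ‖ ^ 2 := by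
  refine IsSqHomogeneous.exists_le_mul ⟨by fun_prop, fun r ℓ => ?_⟩ (.norm_sq _)
    fun ℓ hℓ => by positivity
  simp only [Pi.smul_apply, smul_eq_mul, Finset.mul_sum, mul_pow, mul_left_comm]

theorem exists_lyapQ_le (θbar : ι → ι → ℝ) :
    ∃ C > 0, ∀ q, lyapQ θbar q ≤ C * ∑ i, ∑ j, q i j ^ 2 := by
  simpa only [lyapQ, div_one] using (isSqHomogeneous_lyapQ θbar).exists_le_mul
    (isSqHomogeneous_lyapQ fun _ _ => 1) fun q => lyapQ_pos fun _ _ => one_pos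

theorem mul_sum_sum_sq_le {r : ℝ}
    (ha : ∀ j (v : ι → ℝ), r * ∑ i, v i ^ 2 ≤ ∑ i, v i * pinnedLaplacian a j v i)
    (q : ι → ι → ℝ) : r * ∑ i, ∑ j, q i j ^ 2 ≤
      ∑ i, ∑ j, q i j * pinnedLaplacian a j (fun k => q k j) i := by
  rw [Finset.sum_comm, Finset.sum_comm (f := fun i j => q i j * _), Finset.mul_sum]
  exact Finset.sum_le_sum fun j _ => ha j fun i => q i j

theorem exists_hasDerivWithinAt_lyapQ_le {r : ℝ} (hr : 0 < r)
    (ha : ∀ j (v : ι → ℝ), r * ∑ i, v i ^ 2 ≤ ∑ i, v i * pinnedLaplacian a j v i)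
    (hθbar : ∀ i j, 0 < θbar i j) :
    ∃ c > 0, ∃ C > 0, ∃ L > 0, ∀ (γ : ℝ → ι → ι → ℝ) ℓ u θ s t, 0 < θ →
      HasDerivWithinAt γ (consensusField a θbar θ ℓ u (γ t)) s t →
      ∃ v ≤ θ * (C * ‖ℓ‖ ^ 2 + L * ‖u‖ ^ 2 / θ ^ 2 - c * lyapQ θbar (γ t)),
        HasDerivWithinAt (fun τ => lyapQ θbar (γ τ)) v s t := by
  let form (q : ι → ι → ℝ) : ℝ := ∑ i, ∑ j, q i j * pinnedLaplacian a j (fun k => q k j) i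
  obtain ⟨C₀, hC₀, hQ⟩ := exists_lyapQ_le θbar
  obtain ⟨C, hC, hℓ⟩ := exists_sum_sum_mul_sq_le a
  obtain ⟨L, hL, hu⟩ := exists_sum_sum_mul_sq_le fun i j => -(θbar i j)⁻¹
  refine ⟨r / C₀, by positivity, C * (2 / r), by positivity, L * (2 / r), by positivity,
    fun γ ℓ u θ s t hθ hγ => ⟨_, ?_, hasDerivWithinAt_lyapQ hθbar hγ⟩⟩
  set q := γ t
  have hyoung₁ (i j) : 2 * q i j * (a i j * ℓ j) ≤ r / 2 * q i j ^ 2 + 2 / r * (a i j * ℓ j) ^ 2 :=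
    (two_mul_le_mul_sq_add_sq_div (half_pos hr) _ _).trans_eq (by field_simp)
  have hyoung₂ (i j) : 2 * q i j * (-(θbar i j)⁻¹ * u j) ≤
      θ * (r / 2) * q i j ^ 2 + 2 / r / θ * (-(θbar i j)⁻¹ * u j) ^ 2 :=
    (two_mul_le_mul_sq_add_sq_div (by positivity : 0 < θ * (r / 2)) _ _).trans_eq (by field_simp)
  calc ∑ i, ∑ j, (θ * (2 * q i j * (a i j * ℓ j)) + 2 * q i j * (-(θbar i j)⁻¹ * u j)
        - 2 * θ * (q i j * pinnedLaplacian a j (fun k => q k j) i))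
      ≤ ∑ i, ∑ j, (θ * (r / 2 * q i j ^ 2 + 2 / r * (a i j * ℓ j) ^ 2)
        + (θ * (r / 2) * q i j ^ 2 + 2 / r / θ * (-(θbar i j)⁻¹ * u j) ^ 2)
        - 2 * θ * (q i j * pinnedLaplacian a j (fun k => q k j) i)) := by
        gcongr with i _ j
        exacts [hyoung₁ i j, hyoung₂ i j]
    _ = θ * (r * ∑ i, ∑ j, q i j ^ 2) + θ * (2 / r) * ∑ i, ∑ j, (a i j * ℓ j) ^ 2
        + 2 / r / θ * ∑ i, ∑ j, (-(θbar i j)⁻¹ * u j) ^ 2 - 2 * θ * form q := by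
        simp only [form, mul_add, Finset.sum_add_distrib, Finset.sum_sub_distrib, ← Finset.mul_sum]
        ring
    _ ≤ θ * form q + θ * (2 / r) * (C * ‖ℓ‖ ^ 2) + 2 / r / θ * (L * ‖u‖ ^ 2) - 2 * θ * form q := by
        gcongr
        exacts [mul_sum_sum_sq_le ha q, hℓ ℓ, hu u]
    _ = θ * (C * (2 / r) * ‖ℓ‖ ^ 2 + L * (2 / r) * ‖u‖ ^ 2 / θ ^ 2 - form q) := by
        field_simp
        ring
    _ ≤ θ * (C * (2 / r) * ‖ℓ‖ ^ 2 + L * (2 / r) * ‖u‖ ^ 2 / θ ^ 2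
        - r / C₀ * lyapQ θbar q) := by
        gcongr
        refine le_trans ?_ (mul_sum_sum_sq_le ha q)
        rw [div_mul_eq_mul_div, div_le_iff₀' hC₀, mul_left_comm]
        gcongr
        exact hQ q

end Consensus

section Action

variable {ι : Type*} [Fintype ι] {g : ι → (ι → ℝ) → ℝ} {θbar : ι → ι → ℝ}

/-- Gradient play with estimates: player `i` evaluates its gradient `g i` at `p + q i` instead of
the true profile `p`, and `w` enters with gains `κ i / σ`. -/
def actionField (g : ι → (ι → ℝ) → ℝ) (κ : ι → ℝ) (σ : ℝ) (w p : ι → ℝ) (q : ι → ι → ℝ) : ι → ℝ :=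
  fun i => -g i (p + q i) + κ i * w i / σ

/-- The Lyapunov function of the action errors. -/
def lyapP (p : ι → ℝ) : ℝ :=
  ∑ i, p i ^ 2

theorem isSqHomogeneous_lyapP : IsSqHomogeneous (lyapP (ι := ι)) :=
  ⟨by unfold lyapP; fun_prop, fun r p => by
    simp only [lyapP, Pi.smul_apply, smul_eq_mul, mul_pow, Finset.mul_sum]⟩

theorem lyapP_pos {p : ι → ℝ} (hp : p ≠ 0) : 0 < lyapP p := by
  obtain ⟨i, hi⟩ := Function.ne_iff.1 hp
  exact Finset.sum_pos' (fun _ _ => sq_nonneg _) ⟨i, Finset.mem_univ i, sq_pos_of_ne_zero hi⟩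

theorem exists_estimatedGradient_bounds (hg : ∀ i, ContDiff ℝ 1 (g i))
    (hθbar : ∀ i j, 0 < θbar i j) (R : ℝ) :
    ∃ K ≥ 0, ∀ p q, lyapP p ≤ R → lyapQ θbar q ≤ R →
      ‖fun i => g i (p + q i)‖ ≤ K ∧ ∀ i, |g i p - g i (p + q i)| ≤ K * ‖q‖ := by
  have hG : ContDiff ℝ 1 fun z : (ι → ℝ) × (ι → ι → ℝ) => fun i => g i (z.1 + z.2 i) := by fun_prop
  obtain ⟨ψ, K, L, hK, hL, hψ⟩ := exists_lipschitzWith_bounded_eqOn hG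
    ((isSqHomogeneous_lyapP.isBounded_setOf_le (fun _ => lyapP_pos) R).prod
      ((isSqHomogeneous_lyapQ θbar).isBounded_setOf_le (fun _ => lyapQ_pos hθbar) R))
  refine ⟨max K L, le_max_of_le_left K.2, fun p q hp hq => ?_⟩
  have hψq : ψ (p, q) = fun i => g i (p + q i) := hψ ⟨hp, hq⟩
  have hψ0 : ψ (p, 0) = fun i => g i p := by
    have h0 : lyapQ θbar 0 ≤ R := by
      rw [(isSqHomogeneous_lyapQ θbar).map_zero]
      exact (isSqHomogeneous_lyapP.nonneg (fun _ => lyapP_pos) p).trans hp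
    simpa using hψ (x := (p, 0)) ⟨hp, h0⟩
  refine ⟨hψq ▸ (hL _).trans (le_max_right _ _), fun i => ?_⟩
  have hlip := hK.norm_sub_le (p, 0) (p, q)
  rw [hψ0, hψq, Prod.mk_sub_mk, sub_self, zero_sub, Prod.norm_mk, norm_zero, norm_neg,
    max_eq_right (norm_nonneg _)] at hlip
  exact (norm_le_pi_norm (_ - _ : ι → ℝ) i).trans (hlip.trans (by gcongr; exact le_max_left _ _))

theorem exists_norm_actionField_le (hg : ∀ i, ContDiff ℝ 1 (g i)) (hθbar : ∀ i j, 0 < θbar i j)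
    (κ : ι → ℝ) (R B : ℝ) :
    ∃ U, ∀ p q w σ, 1 ≤ σ → ‖w‖ ≤ B → lyapP p ≤ R → lyapQ θbar q ≤ R →
      ‖actionField g κ σ w p q‖ ≤ U := by
  obtain ⟨K, -, hK⟩ := exists_estimatedGradient_bounds hg hθbar R
  refine ⟨K + ‖κ‖ * B, fun p q w σ hσ hw hp hq => ?_⟩
  have hdrift : ‖σ⁻¹ • (κ * w)‖ ≤ ‖κ‖ * B := by
    rw [norm_smul, norm_inv, Real.norm_of_nonneg (by positivity)]
    calc σ⁻¹ * ‖κ * w‖ ≤ 1 * (‖κ‖ * ‖w‖) := by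
          gcongr
          exacts [inv_le_one_of_one_le₀ hσ, norm_mul_le κ w]
      _ ≤ ‖κ‖ * B := by rw [one_mul]; gcongr
  have hsplit : actionField g κ σ w p q = -(fun i => g i (p + q i)) + σ⁻¹ • (κ * w) := by
    ext i
    simp [actionField, div_eq_inv_mul]
  rw [hsplit]
  exact (norm_add_le _ _).trans (add_le_add ((norm_neg _).trans_le (hK p q hp hq).1) hdrift)

theorem hasDerivWithinAt_lyapP {γ : ℝ → ι → ℝ} {κ : ι → ℝ} {σ t : ℝ} {w : ι → ℝ} {q : ι → ι → ℝ}
    {s : Set ℝ} (hγ : HasDerivWithinAt γ (actionField g κ σ w (γ t) q) s t) :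
    HasDerivWithinAt (fun τ => lyapP (γ τ))
      (∑ i, (2 * γ t i * (g i (γ t) - g i (γ t + q i)) + 2 * γ t i * (κ i * w i / σ)
        - 2 * (γ t i * g i (γ t)))) s t := by
  refine (HasDerivWithinAt.fun_sum fun i _ => (hasDerivWithinAt_pi.1 hγ i).fun_pow 2).congr_deriv
    (Finset.sum_congr rfl fun i _ => ?_)
  simp only [actionField]
  ring

theorem exists_hasDerivWithinAt_lyapP_le (hg : ∀ i, ContDiff ℝ 1 (g i)) {m : ℝ} (hm : 0 < m)
    (hmono : ∀ p, m * ∑ i, p i ^ 2 ≤ ∑ i, p i * g i p) (hθbar : ∀ i j, 0 < θbar i j)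
    (κ : ι → ℝ) (R B : ℝ) :
    ∃ C, ∃ L, ∀ (γ : ℝ → ι → ℝ) q w σ s t, 0 < σ → ‖w‖ ≤ B →
      lyapP (γ t) ≤ R → lyapQ θbar q ≤ R →
      HasDerivWithinAt γ (actionField g κ σ w (γ t) q) s t →
      ∃ v ≤ C * lyapQ θbar q + L / σ ^ 2 - m * lyapP (γ t),
        HasDerivWithinAt (fun τ => lyapP (γ τ)) v s t := by
  obtain ⟨K, hK, hbound⟩ := exists_estimatedGradient_bounds hg hθbar R
  obtain ⟨C, -, hnorm⟩ := (IsSqHomogeneous.norm_sq (ι → ι → ℝ)).exists_le_mul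
    (isSqHomogeneous_lyapQ θbar) fun _ => lyapQ_pos hθbar
  refine ⟨2 / m * (Fintype.card ι * K ^ 2 * C), 2 / m * (Fintype.card ι * (‖κ‖ * B) ^ 2),
    fun γ q w σ s t hσ hw hp hq hγ => ⟨_, ?_, hasDerivWithinAt_lyapP hγ⟩⟩
  set p := γ t
  have hyoung (i) (b : ℝ) : 2 * p i * b ≤ m / 2 * p i ^ 2 + 2 / m * b ^ 2 :=
    (two_mul_le_mul_sq_add_sq_div (half_pos hm) _ _).trans_eq (by field_simp)
  have hgrad : ∑ i, (g i p - g i (p + q i)) ^ 2 ≤ Fintype.card ι * (K * ‖q‖) ^ 2 :=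
    sum_sq_le_of_norm_le (w := fun i => g i p - g i (p + q i))
      ((pi_norm_le_iff_of_nonneg (by positivity)).2 (hbound p q hp hq).2)
  have hdrift : ∑ i, (κ i * w i) ^ 2 ≤ Fintype.card ι * (‖κ‖ * B) ^ 2 :=
    sum_sq_le_of_norm_le (w := κ * w) ((norm_mul_le κ w).trans (by gcongr))
  calc ∑ i, (2 * p i * (g i p - g i (p + q i)) + 2 * p i * (κ i * w i / σ) - 2 * (p i * g i p))
      ≤ ∑ i, ((m / 2 * p i ^ 2 + 2 / m * (g i p - g i (p + q i)) ^ 2)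
        + (m / 2 * p i ^ 2 + 2 / m * (κ i * w i / σ) ^ 2) - 2 * (p i * g i p)) := by
        gcongr with i
        exacts [hyoung i _, hyoung i _]
    _ = 2 / m * ∑ i, (g i p - g i (p + q i)) ^ 2 + 2 / m * (∑ i, (κ i * w i) ^ 2) / σ ^ 2
        + m * ∑ i, p i ^ 2 - 2 * ∑ i, p i * g i p := by
        simp only [div_pow, Finset.sum_add_distrib, Finset.sum_sub_distrib, ← Finset.mul_sum,
          ← Finset.sum_div]
        ring
    _ ≤ 2 / m * (Fintype.card ι * (K * ‖q‖) ^ 2) + 2 / m * (Fintype.card ι * (‖κ‖ * B) ^ 2) / σ ^ 2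
        + m * ∑ i, p i ^ 2 - 2 * (m * ∑ i, p i ^ 2) := by
        gcongr
        exact hmono p
    _ = 2 / m * (Fintype.card ι * K ^ 2 * ‖q‖ ^ 2)
        + 2 / m * (Fintype.card ι * (‖κ‖ * B) ^ 2) / σ ^ 2 - m * lyapP p := by rw [lyapP]; ring
    _ ≤ 2 / m * (Fintype.card ι * K ^ 2 * C) * lyapQ θbar q
        + 2 / m * (Fintype.card ι * (‖κ‖ * B) ^ 2) / σ ^ 2 - m * lyapP p := by
        rw [mul_assoc (2 / m), mul_assoc (_ * _) C]
        gcongr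
        exact hnorm q

end Action

/-- The states `(p, q, e)` of an error system: the action errors, the estimation errors, and the
observer errors. -/
abbrev ErrorSpace (ι : Type*) : Type _ :=
  (ι → ℝ) × (ι → ι → ℝ) × (ι → ℝ) × (ι → ℝ)

/-- The parameters of the closed loop that do not depend on the gains `θ` and `σ`, with the actions
translated so that the equilibrium is the origin. -/
structure ErrorSystem (ι : Type*) where
  g : ι → (ι → ℝ) → ℝ
  a : Matrix ι ι ℝ
  k₁ : ι → ℝ
  k₂ : ι → ℝ
  θbar : ι → ι → ℝ

namespace ErrorSystem

variable {ι : Type*} (S : ErrorSystem ι)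

/-- The combination of the observer errors by which the actions lag behind `p`. Its derivative
contains no `e`, which removes the observer errors from the dynamics of `p`. -/
def lag (e : (ι → ℝ) × (ι → ℝ)) (j : ι) : ℝ :=
  e.1 j - S.k₁ j / S.k₂ j * e.2 j

theorem lag_smul (r : ℝ) (e : (ι → ℝ) × (ι → ℝ)) : S.lag (r • e) = r • S.lag e := by
  ext j
  simp only [lag, Prod.smul_fst, Prod.smul_snd, Pi.smul_apply, smul_eq_mul]
  ring

variable [Fintype ι]

/-- The velocity of `p`. -/
def velocity (σ : ℝ) (w : ι → ℝ) (z : ErrorSpace ι) : ι → ℝ :=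
  actionField S.g (S.k₁ / S.k₂) σ w z.1 z.2.1

/-- The error dynamics of the closed loop when the disturbances have derivative `w`. -/
def field (θ σ : ℝ) (w : ι → ℝ) (z : ErrorSpace ι) : ErrorSpace ι :=
  (S.velocity σ w z, consensusField S.a S.θbar θ (S.lag z.2.2) (S.velocity σ w z) z.2.1,
    observerField S.k₁ S.k₂ σ w z.2.2)

/-- The errors at which none of the three Lyapunov functions exceeds `R`. -/
def sublevel (R : ℝ) : Set (ErrorSpace ι) :=
  {p | lyapP p ≤ R} ×ˢ {q | lyapQ S.θbar q ≤ R} ×ˢ {e | lyapE S.k₁ S.k₂ e ≤ R}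

/-- The sum of the three Lyapunov functions, with weight `r` on that of the observer errors. -/
def totalLyap (r : ℝ) (z : ErrorSpace ι) : ℝ :=
  r * lyapE S.k₁ S.k₂ z.2.2 + lyapQ S.θbar z.2.1 + lyapP z.1

/-- The standing assumptions: smoothness and monotonicity of the gradients, coercivity of the
pinned Laplacians, and positivity of the gains. -/
structure IsAdmissible : Prop where
  contDiff : ∀ i, ContDiff ℝ 1 (S.g i)
  monotone : ∃ m > 0, ∀ p, m * ∑ i, p i ^ 2 ≤ ∑ i, p i * S.g i p
  coercive : ∃ r > 0, ∀ j (v : ι → ℝ), r * ∑ i, v i ^ 2 ≤ ∑ i, v i * pinnedLaplacian S.a j v i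
  k₁_pos : ∀ i, 0 < S.k₁ i
  k₂_pos : ∀ i, 0 < S.k₂ i
  θbar_pos : ∀ i j, 0 < S.θbar i j

/-- `γ` starts in `S.sublevel M` and follows the error dynamics driven by `w` as long as it stays in
`S.sublevel R`. -/
structure IsTrajectory (R M B θ σ t₀ : ℝ) (w : ℝ → ι → ℝ) (γ : ℝ → ErrorSpace ι) : Prop where
  start_mem : γ t₀ ∈ S.sublevel M
  norm_le : ∀ t, t₀ ≤ t → ‖w t‖ ≤ B
  continuousOn : ContinuousOn γ (Ici t₀)
  deriv : ∀ t, t₀ ≤ t → γ t ∈ S.sublevel R →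
    HasDerivWithinAt γ (S.field θ σ (w t) (γ t)) (Ici t₀) t

variable {S}

namespace IsAdmissible

variable (hS : S.IsAdmissible)
include hS

theorem exists_norm_lag_sq_le :
    ∃ C > 0, ∀ e, ‖S.lag e‖ ^ 2 ≤ C * lyapE S.k₁ S.k₂ e := by
  refine IsSqHomogeneous.exists_le_mul ⟨by unfold lag; fun_prop, fun r e => ?_⟩
    (isSqHomogeneous_lyapE S.k₁ S.k₂) fun _ => lyapE_pos S.k₁ hS.k₂_pos
  rw [S.lag_smul, norm_smul, mul_pow, Real.norm_eq_abs, sq_abs]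

theorem lyap_nonneg (z : ErrorSpace ι) :
    0 ≤ lyapE S.k₁ S.k₂ z.2.2 ∧ 0 ≤ lyapQ S.θbar z.2.1 ∧ 0 ≤ lyapP z.1 :=
  ⟨(isSqHomogeneous_lyapE _ _).nonneg (fun _ => lyapE_pos S.k₁ hS.k₂_pos) _,
    (isSqHomogeneous_lyapQ _).nonneg (fun _ => lyapQ_pos hS.θbar_pos) _,
    isSqHomogeneous_lyapP.nonneg (fun _ => lyapP_pos) _⟩

theorem exists_hasDerivWithinAt_lyapQ_le (B : ℝ) :
    ∃ c > 0, ∃ C > 0, ∀ R, ∃ L, ∀ (γ : ℝ → ErrorSpace ι) w θ σ s t, 0 < θ → 1 ≤ σ → ‖w‖ ≤ B →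
      γ t ∈ S.sublevel R → HasDerivWithinAt γ (S.field θ σ w (γ t)) s t →
      ∃ v ≤ θ * (C * lyapE S.k₁ S.k₂ (γ t).2.2 + L / θ ^ 2 - c * lyapQ S.θbar (γ t).2.1),
        HasDerivWithinAt (fun τ => lyapQ S.θbar (γ τ).2.1) v s t := by
  obtain ⟨r, hr, hcoercive⟩ := hS.coercive
  obtain ⟨c, hc, CQ, hCQ, LQ, hLQ, hQ⟩ :=
    NashPI.exists_hasDerivWithinAt_lyapQ_le hr hcoercive hS.θbar_pos
  obtain ⟨Clag, hClag, hlag⟩ := hS.exists_norm_lag_sq_le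
  refine ⟨c, hc, CQ * Clag, by positivity, fun R => ?_⟩
  obtain ⟨U, hU⟩ := exists_norm_actionField_le hS.contDiff hS.θbar_pos (S.k₁ / S.k₂) R B
  refine ⟨LQ * U ^ 2, fun γ w θ σ s t hθ hσ hw hR hγ => ?_⟩
  obtain ⟨v, hv, h⟩ := hQ _ _ _ θ _ t hθ hγ.snd.fst
  refine ⟨v, hv.trans ?_, h⟩
  rw [mul_assoc CQ]
  gcongr
  exacts [hlag _, hU _ _ _ _ hσ hw hR.1 hR.2.1]

theorem exists_isCascade (B : ℝ) :
    ∃ c > 0, ∃ C > 0, ∀ R, ∃ L > 0, ∀ M θ σ t₀ w γ, 0 < θ → 1 ≤ σ →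
      S.IsTrajectory R M B θ σ t₀ w γ → IsCascade c C L M R θ σ t₀
        (fun t => lyapE S.k₁ S.k₂ (γ t).2.2) (fun t => lyapQ S.θbar (γ t).2.1)
        (fun t => lyapP (γ t).1) := by
  obtain ⟨m, hm, hmono⟩ := hS.monotone
  obtain ⟨cE, hcE, LE, hE⟩ := exists_hasDerivWithinAt_lyapE_le hS.k₁_pos hS.k₂_pos B
  obtain ⟨cQ, hcQ, C, hC, hQ⟩ := hS.exists_hasDerivWithinAt_lyapQ_le B
  refine ⟨min cE (min cQ m), by positivity, C, hC, fun R => ?_⟩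
  obtain ⟨LQ, hQ⟩ := hQ R
  obtain ⟨CP, LP, hP⟩ :=
    exists_hasDerivWithinAt_lyapP_le hS.contDiff hm hmono hS.θbar_pos (S.k₁ / S.k₂) R B
  obtain ⟨L, hL, hLE, hLQ, hCP, hLP⟩ := ((eventually_gt_atTop (0 : ℝ)).and <|
    (eventually_ge_atTop LE).and <| (eventually_ge_atTop LQ).and <|
    (eventually_ge_atTop CP).and (eventually_ge_atTop LP)).exists
  refine ⟨L, hL, fun M θ σ t₀ w γ hθ hσ hγ => ?_⟩
  have hσ₀ : 0 < σ := zero_lt_one.trans_le hσ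
  obtain ⟨hP₀, hQ₀, hE₀⟩ := hγ.start_mem
  refine ⟨fun t => hS.lyap_nonneg _, ⟨?_, ?_, ?_⟩, ⟨hE₀, hQ₀, hP₀⟩,
    fun t ht hER hQR hPR => ?_, fun t ht hER hQR hPR => ?_, fun t ht hER hQR hPR => ?_⟩
  · exact (isSqHomogeneous_lyapE _ _).continuous.comp_continuousOn hγ.continuousOn.snd.snd
  · exact (isSqHomogeneous_lyapQ _).continuous.comp_continuousOn hγ.continuousOn.snd.fst
  · exact isSqHomogeneous_lyapP.continuous.comp_continuousOn hγ.continuousOn.fst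
  all_goals
    obtain ⟨hEt, hQt, hPt⟩ := hS.lyap_nonneg (γ t)
    have hder := (hγ.deriv t ht ⟨hPR, hQR, hER⟩).mono (Ici_subset_Ici.2 ht)
    have hw := hγ.norm_le t ht
  · obtain ⟨v, hv, h⟩ := hE _ (w t) σ _ t hσ₀ hw hder.snd.snd
    refine ⟨v, hv.trans ?_, h⟩
    gcongr
    exact min_le_left _ _
  · obtain ⟨v, hv, h⟩ := hQ _ (w t) θ σ _ t hθ hσ hw ⟨hPR, hQR, hER⟩ hder
    refine ⟨v, hv.trans ?_, h⟩
    gcongr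
    exact (min_le_right _ _).trans (min_le_left _ _)
  · obtain ⟨v, hv, h⟩ := hP _ _ (w t) σ _ t hσ₀ hw hPR hQR hder.fst
    refine ⟨v, hv.trans ?_, h⟩
    gcongr
    exact (min_le_right _ _).trans (min_le_right _ _)

theorem eventually_totalLyap_le {M ε : ℝ} (hM : 0 < M) (hε : 0 < ε) (B : ℝ) :
    ∃ R, ∀ᶠ gain : ℝ × ℝ in atTop, 1 ≤ gain.2 ∧ ∀ t₀,
      (∀ w γ, S.IsTrajectory R M B gain.1 gain.2 t₀ w γ → ∀ t, t₀ ≤ t → γ t ∈ S.sublevel R) ∧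
      ∀ᶠ t in atTop, ∀ w γ, S.IsTrajectory R M B gain.1 gain.2 t₀ w γ →
        S.totalLyap (gain.2 ^ 2) (γ t) ≤ ε := by
  obtain ⟨c, hc, C, hC, hcascade⟩ := hS.exists_isCascade B
  obtain ⟨L, hL, hcascade⟩ := hcascade ((1 + C / c) * M + 1)
  refine ⟨(1 + C / c) * M + 1, ?_⟩
  have hε₃ : 0 < ε / 3 := by positivity
  filter_upwards [eventually_isHighGain hc hL hM hε₃ C,
    eventually_ge_atTop ((0, 1) : ℝ × ℝ)] with gain hgain hgain₁
  have hσ : 1 ≤ gain.2 := hgain₁.2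
  have hcas {t₀ w γ} := hcascade M _ _ t₀ w γ hgain.pos.1 hσ
  refine ⟨hσ, fun t₀ => ⟨fun w γ hγ t ht => ?_, ?_⟩⟩
  · obtain ⟨hE, hQ, hP⟩ := (hcas hγ).le_of_isHighGain hgain hc hC.le hL.le hM.le le_rfl ht
    exact ⟨hP, hQ, hE⟩
  · filter_upwards [
      eventually_isCascade_E_le t₀ hgain hc hC.le hL hM.le le_rfl,
      eventually_isCascade_Q_le t₀ hgain hc hC.le hL hM.le le_rfl,
      eventually_isCascade_P_le t₀ hgain hc hC.le hL hM.le le_rfl] with t hE hQ hP w γ hγ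
    have hcas := hcas hγ
    have hE' := (le_div_iff₀' (pow_pos hgain.pos.2 2)).1 (hE _ _ _ hcas)
    have hQ' := (hQ _ _ _ hcas).trans (min_le_left _ _)
    have hP' := hP _ _ _ hcas
    rw [totalLyap]
    linarith

theorem isBounded_sublevel (R : ℝ) : Bornology.IsBounded (S.sublevel R) :=
  (isSqHomogeneous_lyapP.isBounded_setOf_le (fun _ => lyapP_pos) R).prod <|
    ((isSqHomogeneous_lyapQ _).isBounded_setOf_le (fun _ => lyapQ_pos hS.θbar_pos) R).prod <|
    (isSqHomogeneous_lyapE _ _).isBounded_setOf_le (fun _ => lyapE_pos S.k₁ hS.k₂_pos) R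

theorem contDiff_field (θ σ : ℝ) :
    ContDiff ℝ 1 fun y : (ι → ℝ) × ErrorSpace ι => S.field θ σ y.1 y.2 := by
  have := hS.contDiff
  unfold field velocity actionField consensusField observerField pinnedLaplacian lag
  fun_prop

theorem exists_isTrajectory (R : ℝ) {M B t₀ : ℝ} (θ σ : ℝ) {w : ℝ → ι → ℝ}
    (hw : ContinuousOn w (Ici t₀)) (hB : ∀ t, t₀ ≤ t → ‖w t‖ ≤ B) {z : ErrorSpace ι}
    (hz : z ∈ S.sublevel M) : ∃ γ, γ t₀ = z ∧ S.IsTrajectory R M B θ σ t₀ w γ := by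
  obtain ⟨ψ, K, L, hK, hL, hψ⟩ := exists_lipschitzWith_bounded_eqOn (hS.contDiff_field θ σ)
    (Metric.isBounded_closedBall.prod (hS.isBounded_sublevel R))
  obtain ⟨γ, hγ₀, hγ⟩ := exists_hasDerivWithinAt_Ici (F := fun t z => ψ (w t, z))
    (fun t _ => hK.comp (LipschitzWith.prodMk_left (w t)))
    (fun x => hK.continuous.comp_continuousOn (hw.prodMk continuousOn_const))
    (fun t _ x => hL (w t, x)) z
  refine ⟨γ, hγ₀, hγ₀ ▸ hz, hB, fun t ht => (hγ t ht).continuousWithinAt, fun t ht hR => ?_⟩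
  exact (hγ t ht).congr_deriv (hψ ⟨mem_closedBall_zero_iff.2 (hB t ht), hR⟩)

end IsAdmissible

end ErrorSystem

namespace ErrorSystem

variable {ι : Type*} [Fintype ι] (S : ErrorSystem ι)

/-- The squared norm of the stacked errors `x - x̂`, `d - ẑ`, `y i j - x j` and `x - x*`, which are
`e.1`, `σ e.2`, `q i j - lag e j` and `p + lag e`. -/
def stackedNormSq (σ : ℝ) (z : ErrorSpace ι) : ℝ :=
  (∑ i, z.2.2.1 i ^ 2) + (∑ i, (σ * z.2.2.2 i) ^ 2) +
    ((∑ i, ∑ j, (z.2.1 i j - S.lag z.2.2 j) ^ 2) + ∑ i, (z.1 i + S.lag z.2.2 i) ^ 2)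

theorem isSqHomogeneous_stackedNormSq (σ : ℝ) : IsSqHomogeneous (S.stackedNormSq σ) := by
  refine ⟨by unfold stackedNormSq lag; fun_prop, fun r z => ?_⟩
  simp only [stackedNormSq, S.lag_smul, Prod.smul_fst, Prod.smul_snd, Pi.smul_apply, smul_eq_mul,
    mul_left_comm σ r, ← mul_sub, ← mul_add, mul_pow r, ← Finset.mul_sum]

theorem stackedNormSq_mono {σ σ' : ℝ} (hσ : 0 ≤ σ) (hσσ' : σ ≤ σ') (z : ErrorSpace ι) :
    S.stackedNormSq σ z ≤ S.stackedNormSq σ' z := by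
  simp only [stackedNormSq, mul_pow]
  gcongr

theorem isSqHomogeneous_totalLyap (r : ℝ) : IsSqHomogeneous (S.totalLyap r) := by
  have hE := isSqHomogeneous_lyapE S.k₁ S.k₂
  have hQ := isSqHomogeneous_lyapQ S.θbar
  have hP := isSqHomogeneous_lyapP (ι := ι)
  have := hE.continuous
  have := hQ.continuous
  have := hP.continuous
  refine ⟨by unfold totalLyap; fun_prop, fun s z => ?_⟩
  simp only [totalLyap, Prod.smul_fst, Prod.smul_snd, hE.smul, hQ.smul, hP.smul]
  ring

theorem stackedNormSq_pos {z : ErrorSpace ι} (hz : z ≠ 0) : 0 < S.stackedNormSq 1 z := by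
  refine lt_of_le_of_ne (by unfold stackedNormSq; positivity) fun h0 => hz ?_
  obtain ⟨p, q, e₁, e₂⟩ := z
  have hsum {κ : Type _} [Fintype κ] (v : κ → ℝ) : ∑ k, v k ^ 2 = 0 ↔ v = 0 := by
    rw [Fintype.sum_eq_zero_iff_of_nonneg fun k => sq_nonneg (v k)]
    simp [funext_iff]
  rw [stackedNormSq, eq_comm, add_eq_zero_iff_of_nonneg (by positivity) (by positivity),
    add_eq_zero_iff_of_nonneg (by positivity) (by positivity),
    add_eq_zero_iff_of_nonneg (by positivity) (by positivity), ← Fintype.sum_prod_type',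
    hsum, hsum, hsum, hsum] at h0
  obtain ⟨⟨he₁, he₂⟩, hq, hp⟩ := h0
  have hlag : S.lag (e₁, e₂) = 0 := by
    ext j
    simp [lag, show e₁ = 0 from he₁, show e₂ j = 0 by simpa using congrFun he₂ j]
  simp only [hlag, Pi.zero_apply, sub_zero, add_zero, one_mul] at he₁ he₂ hq hp
  have hq : q = 0 := funext₂ fun i j => congrFun hq (i, j)
  exact Prod.ext hp (Prod.ext hq (Prod.ext he₁ he₂))

variable {S}

namespace IsAdmissible

variable (hS : S.IsAdmissible)
include hS

theorem totalLyap_pos {z : ErrorSpace ι} (hz : z ≠ 0) : 0 < S.totalLyap 1 z := by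
  obtain ⟨hE, hQ, hP⟩ := hS.lyap_nonneg z
  obtain ⟨p, q, e⟩ := z
  rw [totalLyap, one_mul]
  by_cases he : e = 0
  · by_cases hq : q = 0
    · have hp : p ≠ 0 := by
        rintro rfl
        simp [he, hq] at hz
      have := lyapP_pos hp
      positivity
    · have := lyapQ_pos hS.θbar_pos hq
      positivity
  · have := lyapE_pos S.k₁ hS.k₂_pos he
    positivity

theorem exists_mem_sublevel {v : ℝ} (hv : 0 < v) :
    ∃ M > 0, ∀ σ z, 1 ≤ σ → S.stackedNormSq σ z ≤ v → z ∈ S.sublevel M := by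
  obtain ⟨C, hC, hle⟩ := (S.isSqHomogeneous_totalLyap 1).exists_le_mul
    (S.isSqHomogeneous_stackedNormSq 1) fun _ => S.stackedNormSq_pos
  refine ⟨C * v, by positivity, fun σ z hσ hz => ?_⟩
  obtain ⟨hE, hQ, hP⟩ := hS.lyap_nonneg z
  have htotal : S.totalLyap 1 z ≤ C * v := calc
    S.totalLyap 1 z ≤ C * S.stackedNormSq 1 z := hle z
    _ ≤ C * S.stackedNormSq σ z := by
      gcongr
      exact S.stackedNormSq_mono zero_le_one hσ z
    _ ≤ C * v := by gcongr
  rw [totalLyap, one_mul] at htotal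
  exact ⟨show lyapP _ ≤ _ by linarith, show lyapQ _ _ ≤ _ by linarith,
    show lyapE _ _ _ ≤ _ by linarith⟩

theorem exists_stackedNormSq_le :
    ∃ C > 0, ∀ σ z, 1 ≤ σ → S.stackedNormSq σ z ≤ C * S.totalLyap (σ ^ 2) z := by
  have hsq : IsSqHomogeneous fun e : (ι → ℝ) × (ι → ℝ) => ∑ i, e.2 i ^ 2 :=
    ⟨by fun_prop, fun r e => by
      simp only [Prod.smul_snd, Pi.smul_apply, smul_eq_mul, mul_pow, Finset.mul_sum]⟩
  obtain ⟨C₁, hC₁, h₁⟩ := (S.isSqHomogeneous_stackedNormSq 1).exists_le_mul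
    (S.isSqHomogeneous_totalLyap 1) fun _ => hS.totalLyap_pos
  obtain ⟨C₂, hC₂, h₂⟩ := hsq.exists_le_mul (isSqHomogeneous_lyapE S.k₁ S.k₂) fun _ =>
    lyapE_pos S.k₁ hS.k₂_pos
  refine ⟨C₁ + C₂, by positivity, fun σ z hσ => ?_⟩
  obtain ⟨hE, hQ, hP⟩ := hS.lyap_nonneg z
  calc S.stackedNormSq σ z ≤ S.stackedNormSq 1 z + σ ^ 2 * ∑ i, z.2.2.2 i ^ 2 := by
        simp only [stackedNormSq, one_mul, mul_pow σ, ← Finset.mul_sum]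
        linarith [Finset.sum_nonneg fun i (_ : i ∈ Finset.univ) => sq_nonneg (z.2.2.2 i)]
    _ ≤ C₁ * S.totalLyap 1 z + σ ^ 2 * (C₂ * lyapE S.k₁ S.k₂ z.2.2) := by
        gcongr
        exacts [h₁ z, h₂ z.2.2]
    _ ≤ C₁ * S.totalLyap (σ ^ 2) z + C₂ * S.totalLyap (σ ^ 2) z := by
        unfold totalLyap
        rw [mul_left_comm]
        gcongr
        · exact one_le_pow₀ hσ
        · linarith
    _ = (C₁ + C₂) * S.totalLyap (σ ^ 2) z := by ring

theorem exists_gains_stackedNormSq_le {v₁ v₂ : ℝ} (hv₁ : 0 < v₁) (hv₂ : 0 < v₂) (B : ℝ) :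
    ∃ M R θs σs : ℝ, 0 < θs ∧ 0 < σs ∧ ∀ θ σ, θs < θ → σs < σ →
      (∀ z, S.stackedNormSq σ z ≤ v₁ → z ∈ S.sublevel M) ∧ ∀ t₀,
      (∀ w γ, S.IsTrajectory R M B θ σ t₀ w γ → ∀ t, t₀ ≤ t → γ t ∈ S.sublevel R) ∧
      ∃ T, t₀ ≤ T ∧ ∀ w γ, S.IsTrajectory R M B θ σ t₀ w γ → ∀ t, T ≤ t →
        S.stackedNormSq σ (γ t) ≤ v₂ := by
  obtain ⟨M, hM, hinit⟩ := hS.exists_mem_sublevel hv₁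
  obtain ⟨C, hC, hfinal⟩ := hS.exists_stackedNormSq_le
  obtain ⟨R, hgain⟩ := hS.eventually_totalLyap_le hM (div_pos hv₂ hC) B
  obtain ⟨⟨θs, σs⟩, hgain⟩ := eventually_atTop.1 hgain
  refine ⟨M, R, max θs 1, max σs 1, by positivity, by positivity, fun θ σ hθ hσ => ?_⟩
  obtain ⟨hσ₁, htraj⟩ := hgain (θ, σ) ⟨(max_lt_iff.1 hθ).1.le, (max_lt_iff.1 hσ).1.le⟩
  refine ⟨fun z => hinit σ z hσ₁, fun t₀ => ⟨(htraj t₀).1, ?_⟩⟩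
  obtain ⟨T, hT, hT₀⟩ :=
    ((eventually_forall_ge_atTop.2 (htraj t₀).2).and (eventually_ge_atTop t₀)).exists
  exact ⟨T, hT₀, fun w γ hγ t ht =>
    (hfinal σ _ hσ₁).trans ((le_div_iff₀' hC).1 (hT t ht w γ hγ))⟩

end IsAdmissible

end ErrorSystem

section ClosedLoop

variable {N : ℕ} {f : Fin N → (Fin N → ℝ) → ℝ} {a : Matrix (Fin N) (Fin N) ℝ} {t₀ : ℝ}
  {d : Fin N → ℝ → ℝ} {k₁ k₂ : Fin N → ℝ} {θbar : Fin N → Fin N → ℝ} {θ σ : ℝ}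
  {xs : Fin N → ℝ}

/-- The error system of the closed loop relative to the profile `xs`. -/
def errorSystem (f : Fin N → (Fin N → ℝ) → ℝ) (a : Matrix (Fin N) (Fin N) ℝ) (k₁ k₂ : Fin N → ℝ)
    (θbar : Fin N → Fin N → ℝ) (xs : Fin N → ℝ) : ErrorSystem (Fin N) where
  g i p := ownPartial f i (xs + p)
  a := a
  k₁ := k₁
  k₂ := k₂
  θbar := θbar

theorem isAdmissible_errorSystem (hN : 2 ≤ N) (hf : ∀ i, ContDiff ℝ 2 (f i))
    {m : ℝ} (hm : 0 < m) (hmono : StronglyMonotone f m) (ha : IsUndirectedConnected a)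
    (hk₁ : ∀ i, 0 < k₁ i) (hk₂ : ∀ i, 0 < k₂ i) (hθbar : ∀ i j, 0 < θbar i j)
    (hxs : IsNash f xs) : (errorSystem f a k₁ k₂ θbar xs).IsAdmissible := by
  have hcrit := (hmono.isNash_iff_ownPartial_eq_zero hm.le
    (fun i => (hf i).differentiable two_ne_zero) xs).1 hxs
  refine ⟨fun i => ?_, ⟨m, hm, fun p => ?_⟩, ha.exists_mul_sum_sq_le hN, hk₁, hk₂, hθbar⟩
  · exact (contDiff_ownPartial hf i).comp (contDiff_const.add contDiff_id)
  · simpa [hcrit, errorSystem] using hmono.mul_sum_sq_le (xs + p) xs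

namespace ErrorSystem

variable (S : ErrorSystem (Fin N))

/-- The errors of the state `s` relative to the profile `xs` when the disturbances have the values
`c`. The disturbance errors are divided by `σ` so that the observer rate is proportional to `σ`. -/
def toErr (σ : ℝ) (xs c : Fin N → ℝ) (s : State N) : ErrorSpace (Fin N) :=
  let e : (Fin N → ℝ) × (Fin N → ℝ) := (fun i => s.x i - s.xhat i, fun i => (c i - s.zhat i) / σ)
  let p : Fin N → ℝ := fun j => s.x j - xs j - S.lag e j
  (p, fun i j => s.y i j - xs j - p j, e)

/-- The state whose errors are `z`, inverse to `toErr`. -/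
def ofErr (σ : ℝ) (xs c : Fin N → ℝ) (z : ErrorSpace (Fin N)) : State N where
  x i := xs i + z.1 i + S.lag z.2.2 i
  y i := xs + (z.1 + z.2.1 i)
  xhat i := xs i + z.1 i + S.lag z.2.2 i - z.2.2.1 i
  zhat i := c i - σ * z.2.2.2 i

theorem ofErr_toErr (hσ : σ ≠ 0) (xs c : Fin N → ℝ) (s : State N) :
    S.ofErr σ xs c (S.toErr σ xs c s) = s := by
  obtain ⟨x, y, xhat, zhat⟩ := s
  simp only [ofErr, toErr, State.mk.injEq]
  refine ⟨funext fun i => by ring, funext₂ fun i j => ?_, funext fun i => by ring,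
    funext fun i => by rw [mul_div_cancel₀ _ hσ, sub_sub_cancel]⟩
  simp only [Pi.add_apply]
  ring

theorem norm_errorVec_le_iff (hσ : σ ≠ 0) {v : ℝ} (hv : 0 ≤ v) (xs c : Fin N → ℝ) (s : State N) :
    ‖errorVec xs c s‖ ≤ v ↔ S.stackedNormSq σ (S.toErr σ xs c s) ≤ v ^ 2 := by
  rw [← sq_le_sq₀ (norm_nonneg _) hv, EuclideanSpace.real_norm_sq_eq, Fintype.sum_sum_type,
    Fintype.sum_sum_type, Fintype.sum_sum_type, Fintype.sum_prod_type]
  have hη (x y xs ℓ : ℝ) : y - xs - (x - xs - ℓ) - ℓ = y - x := by ring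
  simp [errorVec, stackedNormSq, toErr, mul_div_cancel₀ _ hσ, hη]

end ErrorSystem

theorem IsSolution.hasDerivWithinAt_toErr {s : ℝ → State N}
    (hs : IsSolution f a t₀ d k₁ k₂ θbar θ σ s) {w : ℝ → Fin N → ℝ}
    (hd : ∀ i t, t₀ ≤ t → HasDerivWithinAt (d i) (w t i) (Ici t₀) t)
    (hk₂ : ∀ i, k₂ i ≠ 0) (hσ : σ ≠ 0) (xs : Fin N → ℝ) {t : ℝ} (ht : t ∈ Ici t₀) :
    let S := errorSystem f a k₁ k₂ θbar xs
    let γ := fun τ => S.toErr σ xs (fun i => d i τ) (s τ)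
    HasDerivWithinAt γ (S.field θ σ (w t) (γ t)) (Ici t₀) t := by
  intro S γ
  have he₁ : ∀ i, HasDerivWithinAt (fun τ => (γ τ).2.2.1 i)
      ((observerField k₁ k₂ σ (w t) (γ t).2.2).1 i) (Ici t₀) t := fun i =>
    ((hs.ode_x i t ht).sub (hs.ode_xhat i t ht)).congr_deriv (by
      simp only [observerField, γ, ErrorSystem.toErr]
      field_simp
      ring)
  have he₂ : ∀ i, HasDerivWithinAt (fun τ => (γ τ).2.2.2 i)
      ((observerField k₁ k₂ σ (w t) (γ t).2.2).2 i) (Ici t₀) t := fun i =>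
    (((hd i t ht).sub (hs.ode_zhat i t ht)).div_const σ).congr_deriv (by
      simp only [observerField, γ, ErrorSystem.toErr]
      field_simp)
  have hy : ∀ i, xs + ((γ t).1 + (γ t).2.1 i) = (s t).y i := fun i => by
    ext j
    simp [γ, ErrorSystem.toErr]
  have hp : ∀ j, HasDerivWithinAt (fun τ => (γ τ).1 j) (S.velocity σ (w t) (γ t) j) (Ici t₀) t := by
    intro j
    refine (((hs.ode_x j t ht).sub_const (xs j)).sub
      ((he₁ j).sub ((he₂ j).const_mul (k₁ j / k₂ j)))).congr_deriv ?_
    have := hk₂ j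
    simp only [ErrorSystem.velocity, actionField, S, errorSystem, hy, control, observerField,
      Pi.div_apply]
    simp only [γ, ErrorSystem.toErr]
    field_simp
    ring
  have hq : ∀ i j, HasDerivWithinAt (fun τ => (γ τ).2.1 i j)
      (consensusField a θbar θ (S.lag (γ t).2.2) (S.velocity σ (w t) (γ t)) (γ t).2.1 i j)
      (Ici t₀) t := by
    intro i j
    refine (((hs.ode_y i j t ht).sub_const (xs j)).sub (hp j)).congr_deriv ?_
    simp only [consensusField, pinnedLaplacian, γ, ErrorSystem.toErr, sub_sub_sub_cancel_right]
    simp only [S, errorSystem]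
    ring
  exact (hasDerivWithinAt_pi.2 hp).prodMk <|
    (hasDerivWithinAt_pi.2 fun i => hasDerivWithinAt_pi.2 (hq i)).prodMk <|
    (hasDerivWithinAt_pi.2 he₁).prodMk (hasDerivWithinAt_pi.2 he₂)

theorem IsSolution.isTrajectory_toErr {s : ℝ → State N}
    (hs : IsSolution f a t₀ d k₁ k₂ θbar θ σ s) {w : ℝ → Fin N → ℝ} {B M : ℝ}
    (hB : ∀ t, t₀ ≤ t → ‖w t‖ ≤ B)
    (hd : ∀ i t, t₀ ≤ t → HasDerivWithinAt (d i) (w t i) (Ici t₀) t)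
    (hk₂ : ∀ i, k₂ i ≠ 0) (hσ : σ ≠ 0) (R : ℝ)
    (hM : (errorSystem f a k₁ k₂ θbar xs).toErr σ xs (fun i => d i t₀) (s t₀) ∈
      (errorSystem f a k₁ k₂ θbar xs).sublevel M) :
    (errorSystem f a k₁ k₂ θbar xs).IsTrajectory R M B θ σ t₀ w fun t =>
      (errorSystem f a k₁ k₂ θbar xs).toErr σ xs (fun i => d i t) (s t) :=
  have hderiv t (ht : t₀ ≤ t) := hs.hasDerivWithinAt_toErr hd hk₂ hσ xs ht
  ⟨hM, hB, fun t ht => (hderiv t ht).continuousWithinAt, fun t ht _ => hderiv t ht⟩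

theorem isSolution_ofErr {w : ℝ → Fin N → ℝ}
    (hd : ∀ i t, t₀ ≤ t → HasDerivWithinAt (d i) (w t i) (Ici t₀) t)
    (hk₂ : ∀ i, k₂ i ≠ 0) (hσ : σ ≠ 0) {γ : ℝ → ErrorSpace (Fin N)}
    (hγ : ∀ t, t₀ ≤ t → HasDerivWithinAt γ
      ((errorSystem f a k₁ k₂ θbar xs).field θ σ (w t) (γ t)) (Ici t₀) t) :
    IsSolution f a t₀ d k₁ k₂ θbar θ σ fun t =>
      (errorSystem f a k₁ k₂ θbar xs).ofErr σ xs (fun i => d i t) (γ t) := by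
  set S := errorSystem f a k₁ k₂ θbar xs
  have hp i t ht := hasDerivWithinAt_pi.1 (hγ t ht).fst i
  have hq i j t ht := hasDerivWithinAt_pi.1 (hasDerivWithinAt_pi.1 (hγ t ht).snd.fst i) j
  have he₁ i t ht := hasDerivWithinAt_pi.1 (hγ t ht).snd.snd.fst i
  have he₂ i t ht := hasDerivWithinAt_pi.1 (hγ t ht).snd.snd.snd i
  have hx i t (ht : t₀ ≤ t) : HasDerivWithinAt
      (fun τ => (S.ofErr σ xs (fun i => d i τ) (γ τ)).x i)
      (control f (S.ofErr σ xs (fun i => d i t) (γ t)) i + d i t) (Ici t₀) t := by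
    refine (((hp i t ht).const_add (xs i)).add
      ((he₁ i t ht).sub ((he₂ i t ht).const_mul (k₁ i / k₂ i)))).congr_deriv ?_
    have := hk₂ i
    simp only [ErrorSystem.field, ErrorSystem.velocity, actionField, S, errorSystem, control,
      observerField, ErrorSystem.ofErr, Pi.div_apply]
    field_simp
    ring
  refine ⟨hx, fun i j t ht => ?_, fun i t ht => ?_, fun i t ht => ?_⟩
  · refine (((hp j t ht).add (hq i j t ht)).const_add (xs j)).congr_deriv ?_
    simp only [ErrorSystem.field, consensusField, pinnedLaplacian, ErrorSystem.ofErr, Pi.add_apply,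
      add_sub_add_left_eq_sub, S, errorSystem]
    ring
  · refine ((hx i t ht).sub (he₁ i t ht)).congr_deriv ?_
    simp only [ErrorSystem.field, observerField, ErrorSystem.ofErr, S, errorSystem]
    linarith
  · refine ((hd i t ht).sub ((he₂ i t ht).const_mul σ)).congr_deriv ?_
    simp only [ErrorSystem.field, observerField, ErrorSystem.ofErr, S, errorSystem]
    field_simp
    ring

theorem exists_derivWithin_bound (hd : ∀ i, IsAdmissibleDisturbance t₀ (d i)) :
    ∃ (w : ℝ → Fin N → ℝ) (B : ℝ), ContinuousOn w (Ici t₀) ∧ (∀ t, t₀ ≤ t → ‖w t‖ ≤ B) ∧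
      ∀ i t, t₀ ≤ t → HasDerivWithinAt (d i) (w t i) (Ici t₀) t := by
  choose hc b hb using hd
  refine ⟨fun t i => derivWithin (d i) (Ici t₀) t, ‖b‖, ?_, fun t ht => ?_, fun i t ht => ?_⟩
  · exact continuousOn_pi.2 fun i =>
      (hc i).continuousOn_derivWithin (uniqueDiffOn_Ici t₀) le_rfl
  · exact (pi_norm_le_iff_of_nonneg (norm_nonneg b)).2 fun i =>
      ((hb i t ht).trans (le_abs_self _)).trans (norm_le_pi_norm b i)
  · exact ((hc i).differentiableOn one_ne_zero t ht).hasDerivWithinAt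

end ClosedLoop

end NashPI

end

theorem theorem1 (N : ℕ) (hN : 2 ≤ N)
    (f : Fin N → (Fin N → ℝ) → ℝ) (hf : ∀ i, ContDiff ℝ 2 (f i))
    (hmono : ∃ m : ℝ, 0 < m ∧ NashPI.StronglyMonotone f m)
    (a : Matrix (Fin N) (Fin N) ℝ) (ha : NashPI.IsUndirectedConnected a)
    (t₀ : ℝ) (d : Fin N → ℝ → ℝ) (hd : ∀ i, NashPI.IsAdmissibleDisturbance t₀ (d i))
    (k₁ k₂ : Fin N → ℝ) (hk₁ : ∀ i, 0 < k₁ i) (hk₂ : ∀ i, 0 < k₂ i)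
    (θbar : Fin N → Fin N → ℝ) (hθbar : ∀ i j, 0 < θbar i j) :
    (∃! xs : Fin N → ℝ, NashPI.IsNash f xs) ∧
    ∀ xs : Fin N → ℝ, NashPI.IsNash f xs →
      ∀ v₁ v₂ : ℝ, 0 < v₁ → 0 < v₂ →
        ∃ θs σs : ℝ, 0 < θs ∧ 0 < σs ∧
          ∀ θ σ : ℝ, θs < θ → σs < σ →
            (∀ s₀ : NashPI.State N, ‖NashPI.errorVec xs (fun i => d i t₀) s₀‖ ≤ v₁ →
              ∃ s : ℝ → NashPI.State N,
                NashPI.IsSolution f a t₀ d k₁ k₂ θbar θ σ s ∧ s t₀ = s₀) ∧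
            ∃ T : ℝ, t₀ ≤ T ∧
              ∀ s : ℝ → NashPI.State N, NashPI.IsSolution f a t₀ d k₁ k₂ θbar θ σ s →
                ‖NashPI.errorVec xs (fun i => d i t₀) (s t₀)‖ ≤ v₁ →
                ∀ t : ℝ, T ≤ t → ‖NashPI.errorVec xs (fun i => d i t) (s t)‖ ≤ v₂ := by
  obtain ⟨m, hm, hmono⟩ := hmono
  refine ⟨hmono.existsUnique_isNash hm hf, fun xs hxs v₁ v₂ hv₁ hv₂ => ?_⟩
  have hS := NashPI.isAdmissible_errorSystem hN hf hm hmono ha hk₁ hk₂ hθbar hxs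
  obtain ⟨w, B, hw, hwB, hwd⟩ := NashPI.exists_derivWithin_bound hd
  obtain ⟨M, R, θs, σs, hθs, hσs, hgain⟩ :=
    hS.exists_gains_stackedNormSq_le (pow_pos hv₁ 2) (pow_pos hv₂ 2) B
  refine ⟨θs, σs, hθs, hσs, fun θ σ hθ hσ => ?_⟩
  obtain ⟨hinit, htraj⟩ := hgain θ σ hθ hσ
  obtain ⟨hstay, T, hT, hfinal⟩ := htraj t₀
  have hσ₀ : σ ≠ 0 := (hσs.trans hσ).ne'
  have hk₂₀ i : k₂ i ≠ 0 := (hk₂ i).ne'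
  simp only [(NashPI.errorSystem f a k₁ k₂ θbar xs).norm_errorVec_le_iff hσ₀ hv₁.le,
    (NashPI.errorSystem f a k₁ k₂ θbar xs).norm_errorVec_le_iff hσ₀ hv₂.le]
  refine ⟨fun s₀ hs₀ => ?_, T, hT, fun s hs hs₀ =>
    hfinal w _ (hs.isTrajectory_toErr hwB hwd hk₂₀ hσ₀ R (hinit _ hs₀))⟩
  obtain ⟨γ, hγ₀, hγ⟩ := hS.exists_isTrajectory R θ σ hw hwB (hinit _ hs₀)
  have hsol t ht := hγ.deriv t ht (hstay w γ hγ t ht)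
  exact ⟨_, NashPI.isSolution_ofErr hwd hk₂₀ hσ₀ hsol,
    by simp only [hγ₀, NashPI.ErrorSystem.ofErr_toErr _ hσ₀]⟩
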